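/- Throughout, "small" refers to a fixed universe, $\mathbf{Set}$ is the category of small sets, and categories are locally small, not necessarily small. A *lex-weight* is a presheaf $\varphi\colon \mathcal K^{\mathrm{op}}\to\mathbf{Set}$ on a small finitely complete category $\mathcal K$. For a class $\Phi$ of lex-weights and a finitely complete category $\mathcal C$, let $\Phi_l\mathcal C$ be the smallest full replete subcategory of $[\mathcal C^{\mathrm{op}},\mathbf{Set}]$ that contains the representables and is closed under finite limits and under $\Phi$-lex-colimits, i.e. under weighted colimits $\varphi\star D$ with $\varphi\colon \mathcal K^{\mathrm{op}}\to\mathbf{Set}$ in $\Phi$ and $D$ a finite-limit-preserving functor with domain $\mathcal K$. The category $\mathcal C$ is called *$\Phi$-exact* if the restricted Yoneda embedding $\mathcal C\to\Phi_l\mathcal C$ has a left adjoint that preserves finite limits. Let $\mathcal K$ be the free category with finite limits generated by a span $m\colon A\leftarrowtail C\to B\colon f$ with $m$ a monomorphism, and let $\Phi_{\mathrm{adh}}$ consist of the single lex-weight $\varphi\colon\mathcal K^{\mathrm{op}}\to\mathbf{Set}$ given by the pushout in $[\mathcal K^{\mathrm{op}},\mathbf{Set}]$ of $\mathcal K(-,m)$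 and $\mathcal K(-,f)$. **Proposition.** Let $\mathcal C$ be a finitely complete category. The following are equivalent: 1. $\mathcal C$ is $\Phi_{\mathrm{adh}}$-exact; 2. $\mathcal C$ is adhesive: it admits pushouts along monomorphisms, and for every commutative cube in $\mathcal C$ whose bottom face is a pushout along a monomorphism and whose two rear faces are pullbacks, the top face is a pushout if and only if the two front faces are pullbacks; 3. $\mathcal C$ admits pushouts along monomorphisms, these pushouts are stable under pullback (for every pushout square along a monomorphism, with lower right corner $D$, and every morphism $D'\to D$, the square obtained by pulling back along $D'\to D$ is again a pushout), and every pushout square along a monomorphism is also a pullback. -/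

import Mathlib

open CategoryTheory CategoryTheory.Limits Opposite

universe w v v' u u'

noncomputable section

/-! ### Weights for lex colimits, and `Φ`-exactness -/

/-- A lex-weight: a presheaf `φ : Kᵒᵖ ⥤ Set` on a small, finitely complete category `K`
(the presheaf itself is arbitrary). -/
structure LexWeight : Type (w + 1) where
  /-- the (small) domain of the weight -/
  K : Type w
  [cat : SmallCategory K]
  [lex : HasFiniteLimits K]
  /-- the presheaf -/
  φ : Kᵒᵖ ⥤ Type w

attribute [instance] LexWeight.cat LexWeight.lex

/-- Cocones under `D` weighted by the presheaf `φ` (dual to `CategoryTheory.Limits.WeightedCone`).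
A weighted colimit `φ ⋆ D` is a colimiting such cocone: a colimit of the functor
`(k, x ∈ φ k) ↦ D k` on the category of elements of `φ`. -/
abbrev WeightedCocone {K : Type u} [Category.{v} K] {E : Type u'} [Category.{v'} E]
    (φ : Kᵒᵖ ⥤ Type w) (D : K ⥤ E) :=
  Cocone ((CategoryOfElements.π φ).leftOp ⋙ D)

/-- For a class `Φ` of lex-weights and a category `C`, the closure of the representables in
`[Cᵒᵖ, Set]` under finite limits and `Φ`-lex-colimits, i.e. colimits `φ ⋆ D` with `φ ∈ Φ` and
`D` a finite-limit-preserving functor from the domain of `φ`. Since limits (and colimits) are only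
determined up to isomorphism, this closure is replete. -/
inductive LexClosure (Φ : Set LexWeight.{v}) (C : Type u) [Category.{v} C] :
    ObjectProperty (Cᵒᵖ ⥤ Type v)
  | representable (X : C) : LexClosure Φ C (yoneda.obj X)
  | finite_limit {J : Type} [SmallCategory J] [FinCategory J] (F : J ⥤ Cᵒᵖ ⥤ Type v)
      (hF : ∀ j, LexClosure Φ C (F.obj j)) (c : Cone F) (hc : IsLimit c) : LexClosure Φ C c.pt
  | lex_colimit (W : LexWeight.{v}) (hW : W ∈ Φ) (D : W.K ⥤ Cᵒᵖ ⥤ Type v)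
      (hlex : PreservesFiniteLimits D) (hD : ∀ k, LexClosure Φ C (D.obj k))
      (c : WeightedCocone W.φ D) (hc : IsColimit c) : LexClosure Φ C c.pt

/-- The category `Φ_l C`: the full subcategory of `[Cᵒᵖ, Set]` on the closure of the representables
under finite limits and `Φ`-lex-colimits. -/
abbrev LexCompletion (Φ : Set LexWeight.{v}) (C : Type u) [Category.{v} C] :=
  (LexClosure Φ C).FullSubcategory

/-- The restricted Yoneda embedding `W : C ⥤ Φ_l C`. -/
def lexYoneda (Φ : Set LexWeight.{v}) (C : Type u) [Category.{v} C] : C ⥤ LexCompletion Φ C :=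
  (LexClosure Φ C).lift yoneda LexClosure.representable

/-- A (finitely complete) category `C` is `Φ`-exact if the restricted Yoneda embedding
`W : C ⥤ Φ_l C` has a left adjoint which preserves finite limits. -/
def IsPhiExact (Φ : Set LexWeight.{v}) (C : Type u) [Category.{v} C] [HasFiniteLimits C] : Prop :=
  ∃ L : LexCompletion Φ C ⥤ C, Nonempty (L ⊣ lexYoneda Φ C) ∧ PreservesFiniteLimits L

/-! ### Spans with one leg monic -/

/-- A span `A ↢ C ⟶ B` in `E` whose left leg is a monomorphism. -/
structure MonoSpan (E : Type u) [Category.{v} E] where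
  /-- codomain of the monic leg -/
  A : E
  /-- codomain of the other leg -/
  B : E
  /-- the apex -/
  C : E
  /-- the monic leg -/
  m : C ⟶ A
  /-- the other leg -/
  f : C ⟶ B
  [mono : Mono m]

attribute [instance] MonoSpan.mono

namespace MonoSpan

section

variable {E : Type u} [Category.{v} E]

/-- Morphisms of spans: triples of maps commuting with both legs. -/
@[ext]
structure Hom (S T : MonoSpan E) where
  /-- component at `A` -/
  a : S.A ⟶ T.A
  /-- component at `B` -/
  b : S.B ⟶ T.B
  /-- component at `C` -/
  c : S.C ⟶ T.C
  m_comm : S.m ≫ a = c ≫ T.m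
  f_comm : S.f ≫ b = c ≫ T.f

instance : Category (MonoSpan E) where
  Hom := Hom
  id S := ⟨𝟙 _, 𝟙 _, 𝟙 _, by simp, by simp⟩
  comp g h := ⟨g.a ≫ h.a, g.b ≫ h.b, g.c ≫ h.c,
    by rw [← Category.assoc, g.m_comm, Category.assoc, h.m_comm, Category.assoc],
    by rw [← Category.assoc, g.f_comm, Category.assoc, h.f_comm, Category.assoc]⟩
  id_comp _ := Hom.ext (Category.id_comp _) (Category.id_comp _) (Category.id_comp _)
  comp_id _ := Hom.ext (Category.comp_id _) (Category.comp_id _) (Category.comp_id _)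
  assoc _ _ _ := Hom.ext (Category.assoc _ _ _) (Category.assoc _ _ _) (Category.assoc _ _ _)

@[ext]
theorem hom_ext {S T : MonoSpan E} {g h : S ⟶ T} (ha : g.a = h.a) (hb : g.b = h.b)
    (hc : g.c = h.c) : g = h := Hom.ext ha hb hc

@[simp] theorem id_a (S : MonoSpan E) : Hom.a (𝟙 S) = 𝟙 S.A := rfl
@[simp] theorem id_b (S : MonoSpan E) : Hom.b (𝟙 S) = 𝟙 S.B := rfl
@[simp] theorem id_c (S : MonoSpan E) : Hom.c (𝟙 S) = 𝟙 S.C := rfl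
@[simp] theorem comp_a {S T U : MonoSpan E} (g : S ⟶ T) (h : T ⟶ U) :
    (g ≫ h).a = g.a ≫ h.a := rfl
@[simp] theorem comp_b {S T U : MonoSpan E} (g : S ⟶ T) (h : T ⟶ U) :
    (g ≫ h).b = g.b ≫ h.b := rfl
@[simp] theorem comp_c {S T U : MonoSpan E} (g : S ⟶ T) (h : T ⟶ U) :
    (g ≫ h).c = g.c ≫ h.c := rfl

variable (E) in
/-- The functor `(A ↢ C ⟶ B) ↦ A`. -/
@[simps] def projA : MonoSpan E ⥤ E where
  obj S := S.A
  map g := g.a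

variable (E) in
/-- The functor `(A ↢ C ⟶ B) ↦ B`. -/
@[simps] def projB : MonoSpan E ⥤ E where
  obj S := S.B
  map g := g.b

variable (E) in
/-- The functor `(A ↢ C ⟶ B) ↦ C`. -/
@[simps] def projC : MonoSpan E ⥤ E where
  obj S := S.C
  map g := g.c

theorem exists_colimit {J : Type u'} [Category.{v'} J] [HasColimitsOfShape J E] (G : J ⥤ E) :
    ∃ (L : E) (ι : ∀ j, G.obj j ⟶ L), (∀ i j (g : i ⟶ j), G.map g ≫ ι j = ι i) ∧
      ∀ (T : E) (t : ∀ j, G.obj j ⟶ T), (∀ i j (g : i ⟶ j), G.map g ≫ t j = t i) →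
        ∃! d : L ⟶ T, ∀ j, ι j ≫ d = t j := by
  refine ⟨colimit G, colimit.ι G, fun i j g => colimit.w G g, fun T t ht => ?_⟩
  refine ⟨colimit.desc G ⟨T, { app := t, naturality := fun i j g => ?_ }⟩, fun j => ?_,
    fun d hd => ?_⟩
  · exact (ht i j g).trans (Category.comp_id _).symm
  · exact colimit.ι_desc _ _
  · apply colimit.hom_ext
    intro j
    rw [colimit.ι_desc]
    exact hd j

/-- Colimits of spans with a monic leg: take colimits of the three objects, replace the apex by the
image of the left leg, and the right object by a pushout. -/
theorem hasColimitsOfShape {J : Type u'} [Category.{v'} J] [HasColimitsOfShape J E] [HasPushouts E]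
    [HasStrongEpiMonoFactorisations E] : HasColimitsOfShape J (MonoSpan E) where
  has_colimit F := by
    obtain ⟨LA, ιA, wA, uA⟩ : ∃ (L : E) (ι : ∀ j, (F.obj j).A ⟶ L),
      (∀ i j (g : i ⟶ j), (F.map g).a ≫ ι j = ι i) ∧
      ∀ (T : E) (t : ∀ j, (F.obj j).A ⟶ T), (∀ i j (g : i ⟶ j), (F.map g).a ≫ t j = t i) →
        ∃! d : L ⟶ T, ∀ j, ι j ≫ d = t j := exists_colimit (F ⋙ projA E)
    obtain ⟨LB, ιB, wB, uB⟩ : ∃ (L : E) (ι : ∀ j, (F.obj j).B ⟶ L),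
      (∀ i j (g : i ⟶ j), (F.map g).b ≫ ι j = ι i) ∧
      ∀ (T : E) (t : ∀ j, (F.obj j).B ⟶ T), (∀ i j (g : i ⟶ j), (F.map g).b ≫ t j = t i) →
        ∃! d : L ⟶ T, ∀ j, ι j ≫ d = t j := exists_colimit (F ⋙ projB E)
    obtain ⟨LC, ιC, wC, uC⟩ : ∃ (L : E) (ι : ∀ j, (F.obj j).C ⟶ L),
      (∀ i j (g : i ⟶ j), (F.map g).c ≫ ι j = ι i) ∧
      ∀ (T : E) (t : ∀ j, (F.obj j).C ⟶ T), (∀ i j (g : i ⟶ j), (F.map g).c ≫ t j = t i) →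
        ∃! d : L ⟶ T, ∀ j, ι j ≫ d = t j := exists_colimit (F ⋙ projC E)
    obtain ⟨μ, hμ, -⟩ := uC LA (fun j => (F.obj j).m ≫ ιA j) fun i j g => by
      rw [← Category.assoc, ← (F.map g).m_comm, Category.assoc, wA]
    obtain ⟨ν, hν, -⟩ := uC LB (fun j => (F.obj j).f ≫ ιB j) fun i j g => by
      rw [← Category.assoc, ← (F.map g).f_comm, Category.assoc, wB]
    obtain ⟨⟨⟨I, i, e, hfac⟩⟩⟩ := HasStrongEpiMonoFactorisations.has_fac μ
    have he : StrongEpi e := by assumption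
    have hcond : ν ≫ pushout.inl ν e = e ≫ pushout.inr ν e := pushout.condition
    have hext : ∀ {T : E} (g h : pushout ν e ⟶ T), pushout.inl ν e ≫ g = pushout.inl ν e ≫ h →
        pushout.inr ν e ≫ g = pushout.inr ν e ≫ h → g = h := fun g h => pushout.hom_ext
    have hdesc : ∀ {T : E} (g : LB ⟶ T) (h : I ⟶ T), ν ≫ g = e ≫ h →
        ∃ d, pushout.inl ν e ≫ d = g ∧ pushout.inr ν e ≫ d = h := fun g h w =>
      ⟨pushout.desc g h w, pushout.inl_desc _ _ _, pushout.inr_desc _ _ _⟩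
    generalize pushout ν e = P, pushout.inl ν e = inl, pushout.inr ν e = inr at hcond hext hdesc
    let c : Cocone F :=
      { pt := { A := LA, B := P, C := I, m := i, f := inr }
        ι :=
          { app := fun j =>
              Hom.mk (ιA j) (ιB j ≫ inl) (ιC j ≫ e)
                (((Category.assoc _ _ _).trans ((congrArg (ιC j ≫ ·) hfac).trans (hμ j))).symm)
                ((((Category.assoc _ _ _).trans (congrArg (ιC j ≫ ·) hcond.symm)).trans
                  ((Category.assoc _ _ _).symm.trans ((congrArg (· ≫ inl) (hν j)).trans
                    (Category.assoc _ _ _)))).symm)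
            naturality := fun j k g => Hom.ext
              ((wA j k g).trans (Category.comp_id _).symm)
              (((Category.assoc _ _ _).symm.trans (congrArg (· ≫ inl) (wB j k g))).trans
                (Category.comp_id _).symm)
              (((Category.assoc _ _ _).symm.trans (congrArg (· ≫ e) (wC j k g))).trans
                (Category.comp_id _).symm) } }
    have key (s : Cocone F) : ∃! d : c.pt ⟶ s.pt, ∀ j, c.ι.app j ≫ d = s.ι.app j := by
      obtain ⟨a, ha, ha'⟩ := uA s.pt.A (fun j => (s.ι.app j).a) fun i j g =>
        congrArg Hom.a (s.w g)
      obtain ⟨b, hb, hb'⟩ := uB s.pt.B (fun j => (s.ι.app j).b) fun i j g =>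
        congrArg Hom.b (s.w g)
      obtain ⟨γ, hγ, hγ'⟩ := uC s.pt.C (fun j => (s.ι.app j).c) fun i j g =>
        congrArg Hom.c (s.w g)
      have sq : CommSq γ e s.pt.m (i ≫ a) := ⟨by
        rw [← Category.assoc, hfac]
        obtain ⟨d, -, hd⟩ := uC s.pt.A (fun j => (s.ι.app j).c ≫ s.pt.m) fun i j g => by
          rw [← Category.assoc]
          exact congrArg (· ≫ s.pt.m) (congrArg Hom.c (s.w g))
        refine (hd _ fun j => ?_).trans (hd _ fun j => ?_).symm
        · rw [← Category.assoc, hγ]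
        · rw [← Category.assoc, hμ, Category.assoc, ha]
          exact (s.ι.app j).m_comm⟩
      have hl : e ≫ sq.lift = γ := sq.fac_left
      have hr : sq.lift ≫ s.pt.m = i ≫ a := sq.fac_right
      have hνb : ν ≫ b = γ ≫ s.pt.f := by
        obtain ⟨d, -, hd⟩ := uC s.pt.B (fun j => (s.ι.app j).c ≫ s.pt.f) fun i j g => by
          rw [← Category.assoc]
          exact congrArg (· ≫ s.pt.f) (congrArg Hom.c (s.w g))
        refine (hd _ fun j => ?_).trans (hd _ fun j => ?_).symm
        · rw [← Category.assoc, hν, Category.assoc, hb]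
          exact (s.ι.app j).f_comm
        · rw [← Category.assoc, hγ]
      obtain ⟨β, hβ, hβ'⟩ := hdesc b (sq.lift ≫ s.pt.f) (by rw [← Category.assoc, hl, hνb])
      refine ⟨Hom.mk a β sq.lift hr.symm hβ', fun j => Hom.ext (ha j) ?_ ?_, fun g hg => ?_⟩
      · exact (Category.assoc _ _ _).trans ((congrArg (ιB j ≫ ·) hβ).trans (hb j))
      · exact (Category.assoc _ _ _).trans ((congrArg (ιC j ≫ ·) hl).trans (hγ j))
      · have ea : g.a = a := ha' _ fun j => congrArg Hom.a (hg j)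
        have ec : g.c = sq.lift := by
          rw [← cancel_mono s.pt.m, hr, ← ea]
          exact g.m_comm.symm
        refine Hom.ext ea (hext _ _ ?_ ?_) ec
        · refine (hb' _ fun j => ?_).trans hβ.symm
          exact (Category.assoc _ _ _).symm.trans (congrArg Hom.b (hg j))
        · refine Eq.trans ?_ hβ'.symm
          rw [← ec]
          exact g.f_comm
    exact ⟨⟨c, { desc := fun s => (key s).choose
                 fac := fun s => (key s).choose_spec.1
                 uniq := fun s => (key s).choose_spec.2 }⟩⟩

end

end MonoSpan

/-! ### The free finitely complete category on a span with one leg monic -/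

namespace FintypeCat.Skeleton

instance : HasFiniteColimits FintypeCat.Skeleton.{w} where
  out _ _ _ := Adjunction.hasColimitsOfShape_of_equivalence FintypeCat.Skeleton.incl

theorem injective_of_mono {X Y : FintypeCat.Skeleton.{w}} (f : X ⟶ Y) [Mono f] :
    Function.Injective (show ULift.{w} (Fin X.len) → ULift.{w} (Fin Y.len) from f) := by
  intro x y h
  let g (z : ULift.{w} (Fin X.len)) : FintypeCat.Skeleton.mk.{w} 1 ⟶ X := fun _ => z
  have : g x = g y := by
    rw [← cancel_mono f]
    funext _
    exact h
  exact congrFun this ⟨(0 : Fin 1)⟩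

theorem strongEpi_of_surjective {X Y : FintypeCat.Skeleton.{w}} (f : X ⟶ Y)
    (hf : Function.Surjective (show ULift.{w} (Fin X.len) → ULift.{w} (Fin Y.len) from f)) :
    StrongEpi f where
  epi := ⟨fun g h e => by
    funext y
    obtain ⟨x, rfl⟩ := hf y
    exact congrFun e x⟩
  llp {A B} i _ := ⟨fun {p q} sq => by
    let s := Function.surjInv hf
    have hs := Function.surjInv_eq hf
    have hr : (show Y ⟶ A from p ∘ s) ≫ i = q := by
      funext y
      refine (congrFun sq.w (s y)).trans ?_
      exact congrArg q (hs y)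
    refine ⟨⟨{ l := p ∘ s, fac_left := ?_, fac_right := hr }⟩⟩
    rw [← cancel_mono i, Category.assoc, hr, sq.w]⟩

instance : HasStrongEpiMonoFactorisations FintypeCat.Skeleton.{w} where
  has_fac {X Y} f := by
    let R := Set.range (show ULift.{w} (Fin X.len) → ULift.{w} (Fin Y.len) from f)
    let t : R ≃ ULift.{w} (Fin (Nat.card R)) := (Finite.equivFin R).trans Equiv.ulift.symm
    let e : X ⟶ FintypeCat.Skeleton.mk.{w} (Nat.card R) := fun x => t ⟨f x, x, rfl⟩
    let i : FintypeCat.Skeleton.mk.{w} (Nat.card R) ⟶ Y := fun z => (t.symm z).1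
    have hi : Mono i := ⟨fun g h p => by
      funext x
      exact t.symm.injective (Subtype.ext (congrFun p x))⟩
    exact ⟨{ I := _, m := i, e := e
             fac := by
              funext x
              exact congrArg Subtype.val (t.symm_apply_apply _)
             e_strong_epi := strongEpi_of_surjective e fun z => by
              obtain ⟨x, hx⟩ := (t.symm z).2
              refine ⟨x, ?_⟩
              have : (⟨f x, x, rfl⟩ : R) = t.symm z := Subtype.ext hx
              exact (congrArg t this).trans (t.apply_symm_apply z) }⟩

end FintypeCat.Skeleton

/-- The free category with finite limits generated by a span `A ↢ C ⟶ B` with one leg monic.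
It is presented as the opposite of the category of finitely presentable models (in `Set`) of the
finite-limit theory of such spans. Those models are the spans of finite sets with one leg
injective; `FintypeCat.Skeleton` is the usual small category of finite sets `{0, …, n - 1}`. -/
abbrev FreeMonoSpan : Type w := (MonoSpan FintypeCat.Skeleton.{w})ᵒᵖ

instance : HasFiniteColimits (MonoSpan FintypeCat.Skeleton.{w}) where
  out _ _ _ := MonoSpan.hasColimitsOfShape

namespace FreeMonoSpan

/-- The object `A` of the generic span: the model `{∗} ↢ ∅ ⟶ ∅` freely generated by an element
of its set `A`. -/
def A : FreeMonoSpan.{w} := op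
  { A := .mk 1, B := .mk 0, C := .mk 0
    m := fun x => x.down.elim0
    f := fun x => x
    mono := ⟨fun _ h _ => funext fun x => (h x).down.elim0⟩ }

/-- The object `B` of the generic span: the model `∅ ↢ ∅ ⟶ {∗}` freely generated by an element
of its set `B`. -/
def B : FreeMonoSpan.{w} := op
  { A := .mk 0, B := .mk 1, C := .mk 0
    m := fun x => x
    f := fun x => x.down.elim0
    mono := ⟨fun _ h _ => funext fun x => (h x).down.elim0⟩ }

/-- The object `C` of the generic span: the model `{∗} ↢ {∗} ⟶ {∗}` freely generated by an element
of its set `C`. -/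
def C : FreeMonoSpan.{w} := op
  { A := .mk 1, B := .mk 1, C := .mk 1
    m := 𝟙 _
    f := 𝟙 _ }

/-- The monic leg `m : C ⟶ A` of the generic span. -/
def m : C.{w} ⟶ A.{w} := Quiver.Hom.op
  (show A.{w}.unop ⟶ C.{w}.unop from
    { a := fun x => x
      b := fun x => x.down.elim0
      c := fun x => x.down.elim0
      m_comm := funext fun x => x.down.elim0
      f_comm := funext fun x => x.down.elim0 })

/-- The other leg `f : C ⟶ B` of the generic span. -/
def f : C.{w} ⟶ B.{w} := Quiver.Hom.op
  (show B.{w}.unop ⟶ C.{w}.unop from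
    { a := fun x => x.down.elim0
      b := fun x => x
      c := fun x => x.down.elim0
      m_comm := funext fun x => x.down.elim0
      f_comm := funext fun x => x.down.elim0 })

/-- The leg `m` of the generic span is indeed monic. -/
instance : Mono m.{w} := by
  have : Epi m.{w}.unop := ⟨fun {T} g h e => by
    have ha : g.a = h.a := congrArg (fun t : A.{w}.unop ⟶ T => MonoSpan.Hom.a t) e
    have hc : g.c = h.c := by
      rw [← cancel_mono T.m]
      exact g.m_comm.symm.trans ((congrArg (fun t => C.{w}.unop.m ≫ t) ha).trans h.m_comm)
    have hb : g.b = h.b :=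
      (Category.id_comp _).symm.trans ((g.f_comm.trans
        ((congrArg (· ≫ T.f) hc).trans h.f_comm.symm)).trans (Category.id_comp _))
    exact MonoSpan.hom_ext ha hb hc⟩
  exact op_mono_of_epi m.{w}.unop

end FreeMonoSpan

/-- The lex-weight for pushouts along monomorphisms: the pushout, in presheaves on the free category
with finite limits generated by a span `m : A ↢ C ⟶ B : f` with `m` monic, of the maps
represented by `m` and `f`. -/
def adhWeight : LexWeight.{w} where
  K := FreeMonoSpan.{w}
  φ := pushout (yoneda.map FreeMonoSpan.m.{w}) (yoneda.map FreeMonoSpan.f.{w})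

/-- The class `Φ_adh` of lex-weights. -/
def PhiAdh : Set LexWeight.{w} := {adhWeight}

/-! ### Stability of pushouts under pullback -/

/-- The commutative square with sides `m, f, g, n` and bottom right corner `D` remains a pushout
after pulling it back along an arbitrary morphism `d : D' ⟶ D`. -/
def IsStablePushout {E : Type u} [Category.{v} E] {C A B D : E}
    (m : C ⟶ A) (f : C ⟶ B) (g : A ⟶ D) (n : B ⟶ D) : Prop :=
  ∀ ⦃C' A' B' D' : E⦄ (m' : C' ⟶ A') (f' : C' ⟶ B') (g' : A' ⟶ D') (n' : B' ⟶ D')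
    (c : C' ⟶ C) (a : A' ⟶ A) (b : B' ⟶ B) (d : D' ⟶ D),
    IsPullback g' a d g → IsPullback n' b d n →
    IsPullback m' c a m → IsPullback f' c b f → CommSq m' f' g' n' →
    IsPushout m' f' g' n'

end

/-! The proof goes 1 → 2 → 3 → 1.

For 1 → 2, the pushout `P` in presheaves of a representable span with one leg monic belongs to the
lex-completion: the span is classified by a lex functor on `FreeMonoSpan` whose values are finite
limits of representables, and `P` is its colimit weighted by `adhWeight`
(`MonoSpan.lexClosure_of_isPushout`). The reflection `L` turns `P` into a pushout in `C`. Since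
presheaf categories are adhesive and `L` preserves finite limits, the van Kampen property descends
to `C`.

2 → 3 is standard: stability is one half of the van Kampen condition, and pushouts along
monomorphisms in an adhesive category are pullbacks.

For 3 → 1, the reflection is sheafification for the canonical topology, with sets taken in a larger
universe because `C` need not be small. The crux is that Yoneda, as a functor to sheaves, preserves
pushouts along monomorphisms (`isPushout_uliftYoneda_map`). By stability the two maps `g : A ⟶ D`
and `n : B ⟶ D` cover `D`. Gluing needs agreement on three overlaps: `A ×_D B` is the apex, since
the square is a pullback; `B ×_D B` is `B`, since `n` is monic; and `A ×_D A` is the union of the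
diagonal and the kernel pair of `f` (`isPushout_kernelPair`), itself a pushout along a monomorphism
and therefore covered by the two pieces. By induction on the closure, sheafification then sends each
object of the lex-completion to a representable sheaf, so it factors through `C`. -/

/-! ### Stable pushouts along monomorphisms -/

/-- Pushouts along monomorphisms exist, are stable under pullback, and are pullbacks. -/
structure HasStableMonoPushouts (C : Type u) [Category.{v} C] : Prop where
  hasPushout : ∀ ⦃X Y Z : C⦄ (m : Z ⟶ X) (f : Z ⟶ Y), Mono m → HasPushout m f
  isStable : ∀ ⦃X Y Z D : C⦄ (m : Z ⟶ X) (f : Z ⟶ Y) (g : X ⟶ D) (n : Y ⟶ D),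
    Mono m → IsPushout m f g n → IsStablePushout m f g n
  isPullback : ∀ ⦃X Y Z D : C⦄ (m : Z ⟶ X) (f : Z ⟶ Y) (g : X ⟶ D) (n : Y ⟶ D),
    Mono m → IsPushout m f g n → IsPullback m f g n

namespace HasStableMonoPushouts

variable {C : Type u} [Category.{v} C]

section

variable (hC : HasStableMonoPushouts C)
include hC

/-- Base change along `n` turns `m` into an identity, because `m` is monic and the square is a
pullback. The opposite side, a projection of the kernel pair of `n`, is then invertible. -/
theorem mono_inr [HasPullbacks C] {A B Z D : C} {m : Z ⟶ A} {f : Z ⟶ B} {g : A ⟶ D} {n : B ⟶ D}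
    [Mono m] (h : IsPushout m f g n) : Mono n := by
  have hp := hC.isPullback m f g n inferInstance h
  have hk : IsPullback (pullback.fst n n) (pullback.snd n n) n n := .of_hasPullback n n
  have hm : IsPullback (𝟙 Z) (𝟙 Z) m m := IsKernelPair.id_of_mono m
  let l : Z ⟶ pullback n n := pullback.lift f f rfl
  have hl₁ : l ≫ pullback.fst n n = f := pullback.lift_fst _ _ _
  have hl₂ : l ≫ pullback.snd n n = f := pullback.lift_snd _ _ _
  have hf : IsPullback l (𝟙 Z) (pullback.snd n n) f := by
    refine IsPullback.of_right ?_ (by simp [hl₂]) hk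
    rw [hl₁]
    simpa [h.w] using hm.paste_horiz hp.flip
  have key := hC.isStable m f g n inferInstance h (𝟙 Z) l f (pullback.fst n n) (𝟙 Z) m
    (pullback.snd n n) n hp.flip hk hm hf ⟨by simp [hl₁]⟩
  have : IsIso (pullback.fst n n) := key.isIso_inr_of_isIso
  exact IsKernelPair.mono_of_isIso_fst hk

/-- The union of two subobjects, formed as a pushout over their intersection, is a subobject. -/
theorem mono_of_isPushout_of_isPullback [HasPullbacks C] {A K S P Q : C} {x : A ⟶ P} {y : K ⟶ P}
    [Mono x] [Mono y] {s : S ⟶ A} {t : S ⟶ K} (hS : IsPullback s t x y) {i : A ⟶ Q} {j : K ⟶ Q}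
    (hQ : IsPushout s t i j) (d : Q ⟶ P) (hi : i ≫ d = x) (hj : j ≫ d = y) : Mono d := by
  have hs : Mono s := ⟨fun a b e => hS.hom_ext e (by
    rw [← cancel_mono y, Category.assoc, Category.assoc, ← hS.w, reassoc_of% e])⟩
  have ht : Mono t := ⟨fun a b e => hS.hom_ext (by
    rw [← cancel_mono x, Category.assoc, Category.assoc, hS.w, reassoc_of% e]) e⟩
  have hxx : IsPullback (𝟙 A) (𝟙 A) x x := IsKernelPair.id_of_mono x
  have hyy : IsPullback (𝟙 K) (𝟙 K) y y := IsKernelPair.id_of_mono y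
  have htt : IsPullback (𝟙 S) (𝟙 S) t t := IsKernelPair.id_of_mono t
  have hss : IsPullback (𝟙 S) (𝟙 S) s s := IsKernelPair.id_of_mono s
  have h₁ : IsPullback i (𝟙 A) d x := by
    -- Base change along `Q ×_P A ⟶ Q` replaces `A` by `A ×_P A = A` and `K` by `K ×_P A = S`. So `Q
    -- ×_P A` is a pushout of `A` and `S` over `S`, that is, `A`.
    have hE : IsPullback (pullback.fst d x) (pullback.snd d x) d x := .of_hasPullback d x
    let a : A ⟶ pullback d x := pullback.lift i (𝟙 A) (by simp [hi])
    let b : S ⟶ pullback d x := pullback.lift (t ≫ j) s (by simp [hj, hS.w])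
    have ha₁ : a ≫ pullback.fst d x = i := pullback.lift_fst _ _ _
    have ha₂ : a ≫ pullback.snd d x = 𝟙 A := pullback.lift_snd _ _ _
    have hb₁ : b ≫ pullback.fst d x = t ≫ j := pullback.lift_fst _ _ _
    have hb₂ : b ≫ pullback.snd d x = s := pullback.lift_snd _ _ _
    have hA : IsPullback a (𝟙 A) (pullback.fst d x) i := by
      refine IsPullback.of_right ?_ (by simp [ha₁]) hE.flip
      rw [ha₂, hi]
      exact hxx
    have hK : IsPullback b t (pullback.fst d x) j := by
      refine IsPullback.of_right ?_ hb₁ hE.flip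
      rw [hb₂, hj]
      exact hS
    have key := hC.isStable s t i j hs hQ s (𝟙 S) a b (𝟙 S) (𝟙 A) t (pullback.fst d x)
      hA hK (IsPullback.of_vert_isIso ⟨by simp⟩) htt
      ⟨pullback.hom_ext (by simp [ha₁, hb₁, hQ.w]) (by simp [ha₂, hb₂])⟩
    have : IsIso a := key.isIso_inl_of_isIso
    exact IsPullback.of_iso hE (asIso a).symm (Iso.refl _) (Iso.refl _) (Iso.refl _)
      (by simp [← ha₁]) (by simp [← cancel_epi a, ha₂]) (by simp) (by simp)
  have h₂ : IsPullback j (𝟙 K) d y := by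
    have hE : IsPullback (pullback.fst d y) (pullback.snd d y) d y := .of_hasPullback d y
    let a : K ⟶ pullback d y := pullback.lift j (𝟙 K) (by simp [hj])
    let b : S ⟶ pullback d y := pullback.lift (s ≫ i) t (by simp [hi, hS.w])
    have ha₁ : a ≫ pullback.fst d y = j := pullback.lift_fst _ _ _
    have ha₂ : a ≫ pullback.snd d y = 𝟙 K := pullback.lift_snd _ _ _
    have hb₁ : b ≫ pullback.fst d y = s ≫ i := pullback.lift_fst _ _ _
    have hb₂ : b ≫ pullback.snd d y = t := pullback.lift_snd _ _ _
    have hA : IsPullback a (𝟙 K) (pullback.fst d y) j := by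
      refine IsPullback.of_right ?_ (by simp [ha₁]) hE.flip
      rw [ha₂, hj]
      exact hyy
    have hK : IsPullback b s (pullback.fst d y) i := by
      refine IsPullback.of_right ?_ hb₁ hE.flip
      rw [hb₂, hi]
      exact hS.flip
    have key := hC.isStable s t i j hs hQ (𝟙 S) t b a (𝟙 S) s (𝟙 K) (pullback.fst d y)
      hK hA hss (IsPullback.of_vert_isIso ⟨by simp⟩)
      ⟨pullback.hom_ext (by simp [ha₁, hb₁, hQ.w]) (by simp [ha₂, hb₂])⟩
    have : IsIso a := key.isIso_inr_of_isIso
    exact IsPullback.of_iso hE (asIso a).symm (Iso.refl _) (Iso.refl _) (Iso.refl _)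
      (by simp [← ha₁]) (by simp [← cancel_epi a, ha₂]) (by simp) (by simp)
  -- By `h₁` and `h₂`, base change along `Q ×_P Q ⟶ Q` leaves `A`, `K` and `S` unchanged. Both `Q
  -- ×_P Q` and `Q` are pushouts of the same span, so the projection is invertible.
  have hR : IsPullback (pullback.fst d d) (pullback.snd d d) d d := .of_hasPullback d d
  let a : A ⟶ pullback d d := pullback.lift i i rfl
  let b : K ⟶ pullback d d := pullback.lift j j rfl
  have ha₁ : a ≫ pullback.fst d d = i := pullback.lift_fst _ _ _
  have ha₂ : a ≫ pullback.snd d d = i := pullback.lift_snd _ _ _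
  have hb₁ : b ≫ pullback.fst d d = j := pullback.lift_fst _ _ _
  have hb₂ : b ≫ pullback.snd d d = j := pullback.lift_snd _ _ _
  have hA : IsPullback a (𝟙 A) (pullback.fst d d) i := by
    refine IsPullback.of_right ?_ (by simp [ha₁]) hR.flip
    rw [ha₂, hi]
    exact h₁
  have hK : IsPullback b (𝟙 K) (pullback.fst d d) j := by
    refine IsPullback.of_right ?_ (by simp [hb₁]) hR.flip
    rw [hb₂, hj]
    exact h₂
  have key := hC.isStable s t i j hs hQ s t a b (𝟙 S) (𝟙 A) (𝟙 K) (pullback.fst d d)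
    hA hK (IsPullback.of_vert_isIso ⟨by simp⟩) (IsPullback.of_vert_isIso ⟨by simp⟩)
    ⟨pullback.hom_ext (by simp [ha₁, hb₁, hQ.w]) (by simp [ha₂, hb₂, hQ.w])⟩
  have : IsIso (pullback.fst d d) := by
    have e : pullback.fst d d = (key.isoIsPushout _ _ hQ).hom :=
      key.hom_ext (by simp [ha₁]) (by simp [hb₁])
    rw [e]
    infer_instance
  exact IsKernelPair.mono_of_isIso_fst hR

/-- The kernel pair of a pushout of `f` along a monomorphism `m` is the union of the diagonal and
of the kernel pair of `f`. -/
theorem isPushout_kernelPair [HasPullbacks C] {A B Z D : C} {m : Z ⟶ A} {f : Z ⟶ B} {g : A ⟶ D}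
    {n : B ⟶ D} [Mono m] (h : IsPushout m f g n) {K P : C} {q₁ q₂ : K ⟶ Z} {p₁ p₂ : P ⟶ A}
    (hK : IsKernelPair f q₁ q₂) (hP : IsKernelPair g p₁ p₂) {δ : Z ⟶ K} {Δ : A ⟶ P} {k : K ⟶ P}
    (hδ₁ : δ ≫ q₁ = 𝟙 Z) (hδ₂ : δ ≫ q₂ = 𝟙 Z) (hΔ₁ : Δ ≫ p₁ = 𝟙 A) (hΔ₂ : Δ ≫ p₂ = 𝟙 A)
    (hk₁ : k ≫ p₁ = q₁ ≫ m) (hk₂ : k ≫ p₂ = q₂ ≫ m) : IsPushout m δ Δ k := by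
  have hp := hC.isPullback m f g n inferInstance h
  have hKext {T : C} {a b : T ⟶ K} (e₁ : a ≫ q₁ = b ≫ q₁) (e₂ : a ≫ q₂ = b ≫ q₂) : a = b :=
    IsPullback.hom_ext hK e₁ e₂
  have hPext {T : C} {a b : T ⟶ P} (e₁ : a ≫ p₁ = b ≫ p₁) (e₂ : a ≫ p₂ = b ≫ p₂) : a = b :=
    IsPullback.hom_ext hP e₁ e₂
  have : IsSplitMono Δ := ⟨⟨⟨p₁, hΔ₁⟩⟩⟩
  have hkm : Mono k := ⟨fun a b e => by
    apply hKext <;> rw [← cancel_mono m, Category.assoc, Category.assoc]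
    · rw [← hk₁, reassoc_of% e]
    · rw [← hk₂, reassoc_of% e]⟩
  have w : m ≫ Δ = δ ≫ k := hPext (by simp [hΔ₁, hk₁, reassoc_of% hδ₁])
    (by simp [hΔ₂, hk₂, reassoc_of% hδ₂])
  -- A pair in the kernel pair of `f` that becomes diagonal in `A` is already diagonal in `Z`, since
  -- `m` is monic.
  have hS : IsPullback m δ Δ k := by
    refine ⟨⟨w⟩, ⟨PullbackCone.IsLimit.mk _ (fun s => s.snd ≫ q₁) (fun s => ?_) (fun s => ?_)
      (fun s a e₁ e₂ => ?_)⟩⟩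
    · have := s.condition =≫ p₁
      simpa [hΔ₁, hk₁] using this.symm
    · have e₁ := s.condition =≫ p₁
      have e₂ := s.condition =≫ p₂
      simp only [Category.assoc, hΔ₁, hΔ₂, hk₁, hk₂, Category.comp_id] at e₁ e₂
      apply hKext
      · simp [hδ₁]
      · rw [← cancel_mono m]
        simp [reassoc_of% hδ₂, ← e₁, ← e₂]
    · simp [← e₂, hδ₁]
  have := hC.hasPushout m δ inferInstance
  have hQ : IsPushout m δ (pushout.inl m δ) (pushout.inr m δ) := .of_hasPushout m δ
  have hri : Mono (pushout.inr m δ) := hC.mono_inr hQ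
  let d : pushout m δ ⟶ P := pushout.desc Δ k w
  have hd₁ : pushout.inl m δ ≫ d = Δ := pushout.inl_desc _ _ _
  have hd₂ : pushout.inr m δ ≫ d = k := pushout.inr_desc _ _ _
  have hdm : Mono d := hC.mono_of_isPushout_of_isPullback hS hQ d hd₁ hd₂
  -- Base change of the given pushout along `g`.
  have hright : IsPushout k q₂ p₂ m := by
    refine hC.isStable m f g n inferInstance h k q₂ p₂ m q₁ p₁ f g (IsPullback.flip hP) hp ?_
      (IsPullback.flip hK) ⟨hk₂⟩
    refine IsPullback.of_right ?_ hk₁ (IsPullback.flip hP)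
    rw [hk₂, h.w]
    exact (IsPullback.flip hK).paste_horiz hp
  -- Pasted after the square defining the union, this one gives a square with two opposite sides
  -- identities, which is a pushout.
  have hright' : IsPushout (pushout.inr m δ) q₂ (d ≫ p₂) m := by
    refine IsPushout.of_left (h₁₁ := δ) (h₂₁ := pushout.inl m δ) (v₁₁ := m) ?_ ?_ hQ.flip |>.flip
    · rw [hδ₂, reassoc_of% hd₁, hΔ₂]
      exact IsPushout.of_horiz_isIso ⟨by simp⟩
    · rw [reassoc_of% hd₂, hk₂]
  -- Cancelling `hright'` from `hright` leaves a pushout along the monomorphism `d`. It is also a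
  -- pullback, so `d` is a base change of `𝟙 A`.
  have hlast : IsPushout d (d ≫ p₂) p₂ (𝟙 A) := by
    refine IsPushout.of_left (h₁₁ := pushout.inr m δ) (v₁₁ := q₂) (h₂₁ := m) ?_ (by simp) hright'
    simpa [hd₂] using hright
  have hlast' := hC.isPullback _ _ _ _ hdm hlast
  have : IsIso d := hlast'.isIso_fst_of_isIso
  exact IsPushout.of_iso hQ (Iso.refl _) (Iso.refl _) (Iso.refl _) (asIso d) (by simp) (by simp)
    (by simp [hd₁]) (by simp [hd₂])

end

/-! ### Sheaves for the canonical topology -/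

/-- The sieve generated by two morphisms. -/
def pairSieve {A B D : C} (g : A ⟶ D) (n : B ⟶ D) : Sieve D where
  arrows Y k := (∃ l : Y ⟶ A, l ≫ g = k) ∨ ∃ l : Y ⟶ B, l ≫ n = k
  downward_closed := by
    rintro Y Z _ (⟨l, rfl⟩ | ⟨l, rfl⟩) k
    exacts [.inl ⟨k ≫ l, Category.assoc _ _ _⟩, .inr ⟨k ≫ l, Category.assoc _ _ _⟩]

/-- A compatible family on the sieve is determined by its values at `g` and `n`, which agree on `Z`;
the pushout property glues them. Neither stability nor the pullback property is involved. -/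
theorem isSheafFor_pairSieve_yoneda_obj {A B Z D : C} {m : Z ⟶ A} {f : Z ⟶ B} {g : A ⟶ D}
    {n : B ⟶ D} (h : IsPushout m f g n) (X : C) :
    Presieve.IsSheafFor (yoneda.obj X) (pairSieve g n).arrows := by
  have hg : (pairSieve g n).arrows g := .inl ⟨𝟙 _, Category.id_comp _⟩
  have hn : (pairSieve g n).arrows n := .inr ⟨𝟙 _, Category.id_comp _⟩
  intro x hx
  rw [Presieve.compatible_iff_sieveCompatible] at hx
  have hxg {Y : C} (l : Y ⟶ A) (hl) : x (l ≫ g) hl = l ≫ x g hg := hx g l hg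
  have hxn {Y : C} (l : Y ⟶ B) (hl) : x (l ≫ n) hl = l ≫ x n hn := hx n l hn
  have hw : m ≫ x g hg = f ≫ x n hn := by
    rw [← hxg m (.inl ⟨m, rfl⟩), ← hxn f (.inr ⟨f, rfl⟩)]
    congr 1
    exact h.w
  obtain ⟨t, ht₁, ht₂⟩ : ∃ t : D ⟶ X, g ≫ t = x g hg ∧ n ≫ t = x n hn :=
    ⟨h.desc (x g hg) (x n hn) hw, h.inl_desc _ _ _, h.inr_desc _ _ _⟩
  refine ⟨t, ?_, fun t' ht' => ?_⟩
  · rintro Y _ (⟨l, rfl⟩ | ⟨l, rfl⟩)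
    · exact ((Category.assoc _ _ _).trans (l ≫= ht₁)).trans (hxg l _).symm
    · exact ((Category.assoc _ _ _).trans (l ≫= ht₂)).trans (hxn l _).symm
  · exact h.hom_ext ((ht' g hg).trans ht₁.symm) ((ht' n hn).trans ht₂.symm)

section

variable (hC : HasStableMonoPushouts C)
include hC

/-- The sieve pulled back along any `d` is generated by the two legs of the pulled-back square. By
stability that square is a pushout, so every representable satisfies the sheaf condition
universally. -/
theorem pairSieve_mem_canonicalTopology [HasPullbacks C] {A B Z D : C} {m : Z ⟶ A} {f : Z ⟶ B}
    {g : A ⟶ D} {n : B ⟶ D} [Mono m] (h : IsPushout m f g n) :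
    pairSieve g n ∈ Sheaf.canonicalTopology C D := by
  refine Sheaf.mem_finestTopology_of_forall_isSheafFor ?_
  rintro _ ⟨X, rfl⟩ Y d
  have hA : IsPullback (pullback.fst d g) (pullback.snd d g) d g := .of_hasPullback d g
  have hB : IsPullback (pullback.fst d n) (pullback.snd d n) d n := .of_hasPullback d n
  have hZ : IsPullback (pullback.fst (pullback.snd d g) m) (pullback.snd (pullback.snd d g) m)
    (pullback.snd d g) m := .of_hasPullback _ _
  let l : pullback (pullback.snd d g) m ⟶ pullback d n :=
    pullback.lift (pullback.fst (pullback.snd d g) m ≫ pullback.fst d g)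
      (pullback.snd (pullback.snd d g) m ≫ f)
      (by rw [Category.assoc, Category.assoc, pullback.condition, ← h.w, hZ.w_assoc])
  have hl₁ : l ≫ pullback.fst d n = _ := pullback.lift_fst _ _ _
  have hl₂ : l ≫ pullback.snd d n = _ := pullback.lift_snd _ _ _
  have hZ' : IsPullback l (pullback.snd (pullback.snd d g) m) (pullback.snd d n) f := by
    refine IsPullback.of_right ?_ hl₂ hB
    rw [hl₁, ← h.w]
    exact hZ.paste_horiz hA
  have key := hC.isStable m f g n inferInstance h _ _ _ _ _ _ _ _ hA hB hZ hZ' ⟨hl₁.symm⟩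
  convert isSheafFor_pairSieve_yoneda_obj key X using 2
  ext W k
  constructor
  · rintro (⟨a, ha⟩ | ⟨a, ha⟩)
    · exact .inl ⟨pullback.lift k a ha.symm, pullback.lift_fst _ _ _⟩
    · exact .inr ⟨pullback.lift k a ha.symm, pullback.lift_fst _ _ _⟩
  · rintro (⟨a, rfl⟩ | ⟨a, rfl⟩)
    · exact .inl ⟨a ≫ pullback.snd d g, by rw [Category.assoc, Category.assoc, hA.w]⟩
    · exact .inr ⟨a ≫ pullback.snd d n, by rw [Category.assoc, Category.assoc, hB.w]⟩

theorem existsUnique_glue [HasPullbacks C] {A B Z D : C} {m : Z ⟶ A} {f : Z ⟶ B} {g : A ⟶ D}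
    {n : B ⟶ D} [Mono m] (h : IsPushout m f g n) {T : Cᵒᵖ ⥤ Type w}
    (hT : Presieve.IsSheaf (Sheaf.canonicalTopology C) T) (x : T.obj (op A)) (y : T.obj (op B))
    (hxy : T.map m.op x = T.map f.op y) :
    ∃! z : T.obj (op D), T.map g.op z = x ∧ T.map n.op z = y := by
  have hn : Mono n := hC.mono_inr h
  have hp := hC.isPullback m f g n inferInstance h
  have hx {W : C} (a b : W ⟶ A) (e : a ≫ g = b ≫ g) : T.map a.op x = T.map b.op x := by
    have hK : IsKernelPair f (pullback.fst f f) (pullback.snd f f) := .of_hasPullback f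
    have hP : IsKernelPair g (pullback.fst g g) (pullback.snd g g) := .of_hasPullback g
    let k : pullback f f ⟶ pullback g g :=
      pullback.lift (pullback.fst f f ≫ m) (pullback.snd f f ≫ m)
        (by rw [Category.assoc, Category.assoc, h.w, pullback.condition_assoc])
    let Δ : A ⟶ pullback g g := pullback.lift (𝟙 A) (𝟙 A) rfl
    have hk₁ : k ≫ pullback.fst g g = pullback.fst f f ≫ m := pullback.lift_fst _ _ _
    have hk₂ : k ≫ pullback.snd g g = pullback.snd f f ≫ m := pullback.lift_snd _ _ _
    have hΔ₁ : Δ ≫ pullback.fst g g = 𝟙 A := pullback.lift_fst _ _ _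
    have hΔ₂ : Δ ≫ pullback.snd g g = 𝟙 A := pullback.lift_snd _ _ _
    have key := hC.isPushout_kernelPair h hK hP (pullback.lift_fst (𝟙 Z) (𝟙 Z) rfl)
      (pullback.lift_snd (𝟙 Z) (𝟙 Z) rfl) hΔ₁ hΔ₂ hk₁ hk₂
    have hcov := hC.pairSieve_mem_canonicalTopology key
    -- The two restrictions of `x` agree on the diagonal trivially, and on the kernel pair of `f`
    -- because `x` and `y` agree on `Z`. These two pieces cover `A ×_D A`.
    have huniv : T.map (pullback.fst g g).op x = T.map (pullback.snd g g).op x := by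
      refine (hT _ hcov).isSeparatedFor.ext ?_
      rintro Y _ (⟨l, rfl⟩ | ⟨l, rfl⟩)
      · simp only [← Functor.map_comp_apply, ← op_comp, Category.assoc, hΔ₁, hΔ₂]
      · simp only [← Functor.map_comp_apply, ← op_comp, Category.assoc, hk₁, hk₂]
        simp only [op_comp, Functor.map_comp_apply, hxy]
        simp only [← Functor.map_comp_apply, ← op_comp, pullback.condition]
    have e₁ : pullback.lift a b e ≫ pullback.fst g g = a := pullback.lift_fst _ _ _
    have e₂ : pullback.lift a b e ≫ pullback.snd g g = b := pullback.lift_snd _ _ _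
    calc T.map a.op x = T.map (pullback.lift a b e ≫ pullback.fst g g).op x := by rw [e₁]
      _ = T.map (pullback.lift a b e ≫ pullback.snd g g).op x := by
        rw [op_comp, op_comp, Functor.map_comp_apply, Functor.map_comp_apply, huniv]
      _ = T.map b.op x := by rw [e₂]
  have hxy' {W : C} (a : W ⟶ A) (b : W ⟶ B) (e : a ≫ g = b ≫ n) :
      T.map a.op x = T.map b.op y := by
    calc T.map a.op x = T.map (hp.lift a b e ≫ m).op x := by rw [hp.lift_fst]
      _ = T.map (hp.lift a b e ≫ f).op y := by
        rw [op_comp, op_comp, Functor.map_comp_apply, Functor.map_comp_apply, hxy]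
      _ = T.map b.op y := by rw [hp.lift_snd]
  -- Agreement on the three overlaps makes the section over `k` independent of the chosen
  -- factorization through `g` or `n`.
  have hfam : ∀ (Y : C) (k : Y ⟶ D) (_ : pairSieve g n k), ∃ s : T.obj (op Y),
      (∀ l, l ≫ g = k → T.map l.op x = s) ∧ ∀ l, l ≫ n = k → T.map l.op y = s := by
    rintro Y _ (⟨l, rfl⟩ | ⟨l, rfl⟩)
    · exact ⟨T.map l.op x, fun a e => hx a l e, fun b e => (hxy' l b e.symm).symm⟩
    · exact ⟨T.map l.op y, fun a e => hxy' a l e, fun b e => by rw [(cancel_mono n).1 e]⟩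
  choose s hs₁ hs₂ using hfam
  have hsc : Presieve.FamilyOfElements.SieveCompatible (P := T) (X := D) (S := pairSieve g n) s := by
    intro Y W k l hk
    have hlk := (pairSieve g n).downward_closed hk l
    rcases id hk with ⟨a, ha⟩ | ⟨b, hb⟩
    · refine (hs₁ _ _ hlk (l ≫ a) (by rw [Category.assoc, ha])).symm.trans ?_
      rw [← hs₁ _ k hk a ha, op_comp, Functor.map_comp_apply]
    · refine (hs₂ _ _ hlk (l ≫ b) (by rw [Category.assoc, hb])).symm.trans ?_
      rw [← hs₂ _ k hk b hb, op_comp, Functor.map_comp_apply]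
  have hg : pairSieve g n g := .inl ⟨𝟙 _, Category.id_comp _⟩
  have hn' : pairSieve g n n := .inr ⟨𝟙 _, Category.id_comp _⟩
  obtain ⟨z, hz, -⟩ := hT _ (hC.pairSieve_mem_canonicalTopology h) s
    ((Presieve.compatible_iff_sieveCompatible _).2 hsc)
  refine ⟨z, ⟨?_, ?_⟩, fun z' e => ?_⟩
  · rw [hz g hg, ← hs₁ _ g hg (𝟙 _) (Category.id_comp _)]
    simp
  · rw [hz n hn', ← hs₂ _ n hn' (𝟙 _) (Category.id_comp _)]
    simp
  · refine (hT _ (hC.pairSieve_mem_canonicalTopology h)).isSeparatedFor.ext ?_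
    rintro Y k hk
    rw [hz k hk]
    rcases id hk with ⟨a, rfl⟩ | ⟨b, rfl⟩
    · rw [← hs₁ _ _ hk a rfl, op_comp, Functor.map_comp_apply, e.1]
    · rw [← hs₂ _ _ hk b rfl, op_comp, Functor.map_comp_apply, e.2]

theorem isPushout_uliftYoneda_map [HasPullbacks C] {A B Z D : C} {m : Z ⟶ A} {f : Z ⟶ B}
    {g : A ⟶ D} {n : B ⟶ D} [Mono m] (h : IsPushout m f g n) :
    IsPushout ((Sheaf.canonicalTopology C).uliftYoneda.{w}.map m)
      ((Sheaf.canonicalTopology C).uliftYoneda.{w}.map f)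
      ((Sheaf.canonicalTopology C).uliftYoneda.{w}.map g)
      ((Sheaf.canonicalTopology C).uliftYoneda.{w}.map n) := by
  let J := Sheaf.canonicalTopology C
  have key {T : Sheaf J (Type max v w)} (a : J.uliftYoneda.{w}.obj A ⟶ T)
      (b : J.uliftYoneda.{w}.obj B ⟶ T)
      (e : J.uliftYoneda.{w}.map m ≫ a = J.uliftYoneda.{w}.map f ≫ b) :
      ∃! t : J.uliftYoneda.{w}.obj D ⟶ T,
        J.uliftYoneda.{w}.map g ≫ t = a ∧ J.uliftYoneda.{w}.map n ≫ t = b := by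
    have := hC.existsUnique_glue h ((isSheaf_iff_isSheaf_of_type J T.obj).1 T.property)
      (J.uliftYonedaEquiv a) (J.uliftYonedaEquiv b) (by
        rw [J.uliftYonedaEquiv_naturality, J.uliftYonedaEquiv_naturality, e])
    obtain ⟨z, ⟨hz₁, hz₂⟩, hz⟩ := this
    refine ⟨J.uliftYonedaEquiv.symm z, ⟨?_, ?_⟩, fun t ⟨ht₁, ht₂⟩ => ?_⟩
    · rw [J.uliftYonedaEquiv_symm_naturality_left, hz₁, Equiv.symm_apply_apply]
    · rw [J.uliftYonedaEquiv_symm_naturality_left, hz₂, Equiv.symm_apply_apply]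
    · rw [Equiv.eq_symm_apply]
      exact hz _ ⟨by rw [J.uliftYonedaEquiv_naturality, ht₁],
        by rw [J.uliftYonedaEquiv_naturality, ht₂]⟩
  refine ⟨⟨by rw [← Functor.map_comp, h.w, Functor.map_comp]⟩,
    ⟨PushoutCocone.IsColimit.mk _ (fun s => (key s.inl s.inr s.condition).choose)
      (fun s => (key s.inl s.inr s.condition).choose_spec.1.1)
      (fun s => (key s.inl s.inr s.condition).choose_spec.1.2)
      (fun s t h₁ h₂ => (key s.inl s.inr s.condition).choose_spec.2 t ⟨h₁, h₂⟩)⟩⟩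

end

end HasStableMonoPushouts

/-! ### Colimits weighted by a pushout of representables -/

namespace CategoryTheory

variable {K : Type w} [SmallCategory K] {A B Z : K} {m : Z ⟶ A} {f : Z ⟶ B} {φ : Kᵒᵖ ⥤ Type w}
  {a : yoneda.obj A ⟶ φ} {b : yoneda.obj B ⟶ φ}

/-- The universal property of `φ` tested on presheaves with values in another universe, as needed
for hom-sets of an arbitrary `E`. Both sides are lifted to a common universe, where the pushout
persists. -/
theorem exists_natural_family_of_isPushout (h : IsPushout (yoneda.map m) (yoneda.map f) a b)
    (H : Kᵒᵖ ⥤ Type v') (x : H.obj (op A)) (y : H.obj (op B))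
    (hxy : H.map m.op x = H.map f.op y) :
    ∃ t : ∀ k, φ.obj k → H.obj k, (∀ ⦃k l⦄ (r : k ⟶ l) z, t l (φ.map r z) = H.map r (t k z)) ∧
      t _ (a.app (op A) (𝟙 A)) = x ∧ t _ (b.app (op B) (𝟙 B)) = y := by
  have h' := h.map ((Functor.whiskeringRight Kᵒᵖ _ _).obj uliftFunctor.{v', w})
  let p : uliftYoneda.{v'}.obj A ⟶ H ⋙ uliftFunctor.{w, v'} := uliftYonedaEquiv.symm ⟨x⟩
  let q : uliftYoneda.{v'}.obj B ⟶ H ⋙ uliftFunctor.{w, v'} := uliftYonedaEquiv.symm ⟨y⟩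
  have hpq : uliftYoneda.{v'}.map m ≫ p = uliftYoneda.{v'}.map f ≫ q := by
    refine (uliftYonedaEquiv_symm_map m.op _).symm.trans
      (Eq.trans ?_ (uliftYonedaEquiv_symm_map f.op _))
    congr 1
    exact ULift.ext _ _ hxy
  let d := h'.desc p q hpq
  refine ⟨fun k z => (d.app k ⟨z⟩).down, fun k l r z => ?_, ?_, ?_⟩
  · exact congrArg ULift.down (NatTrans.naturality_apply d r ⟨z⟩)
  · have := ConcreteCategory.congr_hom (congr_app (h'.inl_desc p q hpq) (op A)) ⟨𝟙 A⟩
    exact (congrArg ULift.down this).trans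
      (congrArg ULift.down (uliftYonedaEquiv.{v'}.apply_symm_apply
        (show (H ⋙ uliftFunctor.{w, v'}).obj (op A) from ⟨x⟩)))
  · have := ConcreteCategory.congr_hom (congr_app (h'.inr_desc p q hpq) (op B)) ⟨𝟙 B⟩
    exact (congrArg ULift.down this).trans
      (congrArg ULift.down (uliftYonedaEquiv.{v'}.apply_symm_apply
        (show (H ⋙ uliftFunctor.{w, v'}).obj (op B) from ⟨y⟩)))

/-- Weighted colimits are cocontinuous in the weight, and a representable weight evaluates the
diagram. The argument is made on elements, so `E` need not have any colimits. -/
theorem isPushout_of_isColimit_weightedCocone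
    (h : IsPushout (yoneda.map m) (yoneda.map f) a b) {E : Type u'} [Category.{v'} E] (D : K ⥤ E)
    {c : WeightedCocone φ D} (hc : IsColimit c) :
    IsPushout (D.map m) (D.map f) (c.ι.app (op (φ.elementsMk (op A) (a.app (op A) (𝟙 A)))))
      (c.ι.app (op (φ.elementsMk (op B) (b.app (op B) (𝟙 B))))) := by
  let ι {k : K} (z : φ.obj (op k)) : D.obj k ⟶ c.pt := c.ι.app (op (φ.elementsMk (op k) z))
  have hι {k l : K} (r : l ⟶ k) (z : φ.obj (op k)) (z' : φ.obj (op l)) (e : φ.map r.op z = z') :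
      D.map r ≫ ι z = ι z' :=
    c.w (Quiver.Hom.op (CategoryOfElements.homMk (φ.elementsMk (op k) z) (φ.elementsMk (op l) z')
      r.op e))
  have ha {k : K} (r : k ⟶ A) : φ.map r.op (a.app (op A) (𝟙 A)) = a.app (op k) r := by
    rw [← NatTrans.naturality_apply]
    simp
  have hb {k : K} (r : k ⟶ B) : φ.map r.op (b.app (op B) (𝟙 B)) = b.app (op k) r := by
    rw [← NatTrans.naturality_apply]
    simp
  have hw : a.app (op Z) m = b.app (op Z) f := by
    have := ConcreteCategory.congr_hom (congr_app h.w (op Z)) (𝟙 Z)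
    simpa using this
  have key {T : E} (s : D.obj A ⟶ T) (t : D.obj B ⟶ T) (e : D.map m ≫ s = D.map f ≫ t) :
      ∃ d : c.pt ⟶ T, ι (a.app (op A) (𝟙 A)) ≫ d = s ∧
        ι (b.app (op B) (𝟙 B)) ≫ d = t := by
    obtain ⟨τ, hτ, hτ₁, hτ₂⟩ := exists_natural_family_of_isPushout h (D.op ⋙ yoneda.obj T) s t e
    let c' : WeightedCocone φ D :=
      { pt := T
        ι :=
          { app := fun p => τ p.unop.1 p.unop.2
            naturality := fun p q r => by
              refine Eq.trans ?_ (Category.comp_id _).symm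
              refine (hτ r.unop.1 q.unop.2).symm.trans ?_
              rw [r.unop.2] } }
    refine ⟨hc.desc c', (hc.fac c' _).trans hτ₁, (hc.fac c' _).trans hτ₂⟩
  refine ⟨⟨(hι m _ _ (ha m)).trans ((hι f _ _ ((hb f).trans hw.symm)).symm)⟩,
    ⟨PushoutCocone.IsColimit.mk _ (fun s => (key s.inl s.inr s.condition).choose)
      (fun s => (key s.inl s.inr s.condition).choose_spec.1)
      (fun s => (key s.inl s.inr s.condition).choose_spec.2) (fun s d e₁ e₂ => ?_)⟩⟩
  obtain ⟨e₁', e₂'⟩ := (key s.inl s.inr s.condition).choose_spec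
  generalize (key s.inl s.inr s.condition).choose = d' at e₁' e₂'
  refine hc.hom_ext ?_
  rintro ⟨⟨⟨k⟩, z⟩⟩
  -- Each element of `φ` is a restriction of one of the two generators, so a map out of the colimit
  -- is determined by its two components there.
  obtain ⟨r, rfl⟩ | ⟨r, rfl⟩ :
      (∃ r : k ⟶ A, a.app (op k) r = z) ∨ ∃ r : k ⟶ B, b.app (op k) r = z :=
    Types.eq_or_eq_of_isPushout (h.app (op k)) z
  · change ι (a.app (op k) r) ≫ d = ι (a.app (op k) r) ≫ d'
    rw [← hι r _ _ (ha r), Category.assoc, Category.assoc, e₁']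
    exact D.map r ≫= e₁
  · change ι (b.app (op k) r) ≫ d = ι (b.app (op k) r) ≫ d'
    rw [← hι r _ _ (hb r), Category.assoc, Category.assoc, e₂']
    exact D.map r ≫= e₂

end CategoryTheory

theorem isPushout_of_isColimit_adhWeight {E : Type u'} [Category.{v'} E]
    (D : FreeMonoSpan.{w} ⥤ E) {c : WeightedCocone adhWeight.{w}.φ D} (hc : IsColimit c) :
    ∃ (i : D.obj FreeMonoSpan.A ⟶ c.pt) (j : D.obj FreeMonoSpan.B ⟶ c.pt),
      IsPushout (D.map FreeMonoSpan.m) (D.map FreeMonoSpan.f) i j :=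
  ⟨_, _, isPushout_of_isColimit_weightedCocone
    (IsPushout.of_hasPushout (yoneda.map FreeMonoSpan.m.{w}) (yoneda.map FreeMonoSpan.f.{w})) D hc⟩

noncomputable section

namespace CategoryTheory.Sheaf

variable (C : Type u) [Category.{v} C]

/-! ### Sheafification of small presheaves for the canonical topology -/

/-- Sheafification for the canonical topology, in a large enough universe. -/
def canonicalSheafification :
    (Cᵒᵖ ⥤ Type v) ⥤ Sheaf (canonicalTopology C) (Type (max v u)) :=
  (Functor.whiskeringRight Cᵒᵖ (Type v) (Type max v u)).obj uliftFunctor.{u, v} ⋙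
    presheafToSheaf (canonicalTopology C) (Type (max v u))

instance : PreservesFiniteLimits (canonicalSheafification C) := by
  unfold canonicalSheafification
  have : PreservesFiniteLimits
      ((Functor.whiskeringRight Cᵒᵖ (Type v) (Type max v u)).obj uliftFunctor.{u, v}) :=
    ⟨fun J _ _ => inferInstance⟩
  exact comp_preservesFiniteLimits _ _

instance : PreservesColimitsOfShape WalkingSpan (canonicalSheafification C) := by
  unfold canonicalSheafification
  infer_instance

/-- Representable presheaves are sheaves. -/
def yonedaCompCanonicalSheafification :
    yoneda ⋙ canonicalSheafification C ≅ (canonicalTopology C).uliftYoneda.{u} :=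
  Functor.isoWhiskerLeft (canonicalTopology C).uliftYoneda.{u}
    (asIso (sheafificationAdjunction (canonicalTopology C) (Type (max v u))).counit)

end CategoryTheory.Sheaf

open CategoryTheory.Sheaf

variable {C : Type u} [Category.{v} C]

/-! ### Finite limits in the lex-completion -/

instance LexClosure.isClosedUnderLimitsOfShape (Φ : Set LexWeight.{v}) (J : Type)
    [SmallCategory J] [FinCategory J] : (LexClosure Φ C).IsClosedUnderLimitsOfShape J where
  limitsOfShape_le := fun _ ⟨h⟩ => .finite_limit h.diag h.prop_diag_obj ⟨_, h.π⟩ h.isLimit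

instance LexClosure.preservesFiniteLimits_ι (Φ : Set LexWeight.{v}) :
    PreservesFiniteLimits (LexClosure Φ C).ι where
  preservesFiniteLimits _ _ _ := inferInstance

theorem FreeMonoSpan.mono_map_m {E : Type u'} [Category.{v'} E] (D : FreeMonoSpan.{w} ⥤ E)
    (hD : PreservesFiniteLimits D) : Mono (D.map FreeMonoSpan.m) := inferInstance

/-! ### From stable pushouts to exactness -/

namespace HasStableMonoPushouts

theorem essImage_canonicalSheafification_obj [HasFiniteLimits C] (hC : HasStableMonoPushouts C)
    {P : Cᵒᵖ ⥤ Type v} (hP : LexClosure PhiAdh.{v} C P) :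
    (canonicalTopology C).uliftYoneda.{u}.essImage ((canonicalSheafification C).obj P) := by
  induction hP with
  | representable X => exact ⟨X, ⟨((yonedaCompCanonicalSheafification C).app X).symm⟩⟩
  | finite_limit F hF c hc ih =>
    exact ObjectProperty.prop_of_isLimit _ (isLimitOfPreserves (canonicalSheafification C) hc) ih
  | lex_colimit W hW D hlex hD c hc ih =>
    obtain rfl : W = adhWeight := hW
    obtain ⟨i, j, h⟩ := isPushout_of_isColimit_adhWeight D hc
    have h' := h.map (canonicalSheafification C)
    let Y := (canonicalTopology C).uliftYoneda.{u}
    let G := Functor.essImage.liftFunctor (D ⋙ canonicalSheafification C) Y ih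
    let e : G ⋙ Y ≅ D ⋙ canonicalSheafification C := Functor.essImage.liftFunctorCompIso _ Y ih
    -- `G` is lex because `G ⋙ Y` is and `Y`, being fully faithful, reflects limits. The pushout of
    -- the image of the generic span therefore exists in `C`, and `Y` preserves it.
    have hm : Mono (G.map FreeMonoSpan.m) := by
      have : PreservesFiniteLimits (D ⋙ canonicalSheafification C) :=
        comp_preservesFiniteLimits _ _
      have : PreservesFiniteLimits (G ⋙ Y) :=
        ⟨fun K _ _ => preservesLimitsOfShape_of_natIso e.symm⟩
      have : PreservesFiniteLimits G := preservesFiniteLimits_of_reflects_of_preserves G Y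
      exact FreeMonoSpan.mono_map_m G this
    have := hC.hasPushout (G.map FreeMonoSpan.m) (G.map FreeMonoSpan.f) hm
    have hE := hC.isPushout_uliftYoneda_map.{u}
      (IsPushout.of_hasPushout (G.map FreeMonoSpan.m) (G.map FreeMonoSpan.f))
    have h'' := IsPushout.of_iso' h' (e.app _) (e.app _) (e.app _) (Iso.refl _)
      (e.hom.naturality _).symm (e.hom.naturality _).symm
      (Category.comp_id _).symm (Category.comp_id _).symm
    exact ⟨_, ⟨hE.isoIsPushout _ _ h''⟩⟩

theorem isPhiExact [HasFiniteLimits C] (hC : HasStableMonoPushouts C) :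
    IsPhiExact PhiAdh.{v} C := by
  let J := canonicalTopology C
  let S : LexCompletion PhiAdh.{v} C ⥤ Sheaf J (Type (max v u)) :=
    (LexClosure PhiAdh.{v} C).ι ⋙ canonicalSheafification C
  have hS : ∀ P, J.uliftYoneda.{u}.essImage (S.obj P) := fun P =>
    hC.essImage_canonicalSheafification_obj P.property
  let L : LexCompletion PhiAdh.{v} C ⥤ C := Functor.essImage.liftFunctor S J.uliftYoneda.{u} hS
  let e : L ⋙ J.uliftYoneda.{u} ≅ S := Functor.essImage.liftFunctorCompIso S _ hS
  refine ⟨L, ⟨?_⟩, ?_⟩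
  -- The sheafification adjunction is restricted along the full embeddings of the lex-completion
  -- into large presheaves and of `C` into sheaves.
  · exact Adjunction.restrictFullyFaithful
      (iC := (LexClosure PhiAdh.{v} C).ι ⋙
        (Functor.whiskeringRight Cᵒᵖ (Type v) (Type max v u)).obj uliftFunctor.{u, v})
      (iD := J.uliftYoneda.{u})
      (sheafificationAdjunction J (Type (max v u)))
      (((LexClosure PhiAdh.{v} C).fullyFaithfulι).comp (fullyFaithfulULiftFunctor.whiskeringRight _))
      J.fullyFaithfulUliftYoneda e.symm (Iso.refl _)
  · have : PreservesFiniteLimits S := comp_preservesFiniteLimits _ _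
    have : PreservesFiniteLimits (L ⋙ J.uliftYoneda.{u}) := ⟨fun K _ _ =>
      preservesLimitsOfShape_of_natIso e.symm⟩
    exact preservesFiniteLimits_of_reflects_of_preserves L J.uliftYoneda.{u}

end HasStableMonoPushouts

/-! ### The universal property of the free finitely complete category on a span -/

namespace MonoSpan

/-- Spans of finite sets, as spans of sets. -/
def incl : MonoSpan FintypeCat.Skeleton.{v} ⥤ MonoSpan (Type v) where
  obj S :=
    { A := ULift.{v} (Fin S.A.len)
      B := ULift.{v} (Fin S.B.len)
      C := ULift.{v} (Fin S.C.len)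
      m := ↾S.m
      f := ↾S.f
      mono := (mono_iff_injective _).2 (FintypeCat.Skeleton.injective_of_mono S.m) }
  map g :=
    { a := ↾g.a
      b := ↾g.b
      c := ↾g.c
      m_comm := congrArg TypeCat.ofHom g.m_comm
      f_comm := congrArg TypeCat.ofHom g.f_comm }

instance (S : MonoSpan FintypeCat.Skeleton.{v}) : Finite (incl.obj S).A :=
  inferInstanceAs (Finite (ULift (Fin _)))

instance (S : MonoSpan FintypeCat.Skeleton.{v}) : Finite (incl.obj S).B :=
  inferInstanceAs (Finite (ULift (Fin _)))

instance (S : MonoSpan FintypeCat.Skeleton.{v}) : Finite (incl.obj S).C :=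
  inferInstanceAs (Finite (ULift (Fin _)))

theorem m_comm_apply {S T : MonoSpan (Type v)} (g : S ⟶ T) (x : S.C) :
    g.a (S.m x) = T.m (g.c x) := ConcreteCategory.congr_hom g.m_comm x

theorem f_comm_apply {S T : MonoSpan (Type v)} (g : S ⟶ T) (x : S.C) :
    g.b (S.f x) = T.f (g.c x) := ConcreteCategory.congr_hom g.f_comm x

/-- A finite part of a span of sets which is closed under both legs is a span of finite sets. -/
theorem exists_incl_obj_hom (T : MonoSpan (Type v)) (α : Set T.A) (β : Set T.B) (γ : Set T.C)
    [Finite α] [Finite β] [Finite γ] (hm : ∀ x ∈ γ, T.m x ∈ α) (hf : ∀ x ∈ γ, T.f x ∈ β) :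
    ∃ (S : MonoSpan FintypeCat.Skeleton.{v}) (j : incl.obj S ⟶ T),
      (Function.Injective j.a ∧ Function.Injective j.b ∧ Function.Injective j.c) ∧
      (∀ x ∈ α, ∃ y, j.a y = x) ∧ (∀ x ∈ β, ∃ y, j.b y = x) ∧ ∀ x ∈ γ, ∃ y, j.c y = x := by
  let ea : α ≃ ULift.{v} (Fin (Nat.card α)) := (Finite.equivFin α).trans Equiv.ulift.symm
  let eb : β ≃ ULift.{v} (Fin (Nat.card β)) := (Finite.equivFin β).trans Equiv.ulift.symm
  let ec : γ ≃ ULift.{v} (Fin (Nat.card γ)) := (Finite.equivFin γ).trans Equiv.ulift.symm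
  let m : FintypeCat.Skeleton.mk.{v} (Nat.card γ) ⟶ FintypeCat.Skeleton.mk.{v} (Nat.card α) :=
    fun x => ea ⟨T.m (ec.symm x), hm _ (ec.symm x).2⟩
  let f : FintypeCat.Skeleton.mk.{v} (Nat.card γ) ⟶ FintypeCat.Skeleton.mk.{v} (Nat.card β) :=
    fun x => eb ⟨T.f (ec.symm x), hf _ (ec.symm x).2⟩
  have hT : Function.Injective T.m := (mono_iff_injective _).1 inferInstance
  have hm' : Mono m := ⟨fun g h p => by
    funext x
    have := congrArg Subtype.val (ea.injective (congrFun p x))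
    exact ec.symm.injective (Subtype.ext (hT this))⟩
  refine ⟨{ A := _, B := _, C := _, m := m, f := f },
    { a := ↾fun x => (ea.symm x).1
      b := ↾fun x => (eb.symm x).1
      c := ↾fun x => (ec.symm x).1
      m_comm := ?_
      f_comm := ?_ }, ⟨?_, ?_, ?_⟩, ?_, ?_, ?_⟩
  · ext x
    exact congrArg Subtype.val (ea.symm_apply_apply _)
  · ext x
    exact congrArg Subtype.val (eb.symm_apply_apply _)
  · exact fun x y e => ea.symm.injective (Subtype.ext e)
  · exact fun x y e => eb.symm.injective (Subtype.ext e)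
  · exact fun x y e => ec.symm.injective (Subtype.ext e)
  · exact fun x hx => ⟨ea ⟨x, hx⟩, congrArg Subtype.val (ea.symm_apply_apply _)⟩
  · exact fun x hx => ⟨eb ⟨x, hx⟩, congrArg Subtype.val (eb.symm_apply_apply _)⟩
  · exact fun x hx => ⟨ec ⟨x, hx⟩, congrArg Subtype.val (ec.symm_apply_apply _)⟩

section

variable {T : MonoSpan (Type v)} {S : MonoSpan FintypeCat.Skeleton.{v}} {j : incl.obj S ⟶ T}

theorem exists_incl_map_comp
    (hj : Function.Injective j.a ∧ Function.Injective j.b ∧ Function.Injective j.c)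
    {R : MonoSpan FintypeCat.Skeleton.{v}} (t : incl.obj R ⟶ T) (ha : ∀ x, ∃ y, j.a y = t.a x)
    (hb : ∀ x, ∃ y, j.b y = t.b x) (hc : ∀ x, ∃ y, j.c y = t.c x) :
    ∃ s : R ⟶ S, incl.map s ≫ j = t := by
  choose a ha using ha
  choose b hb using hb
  choose c hc using hc
  refine ⟨{ a := a, b := b, c := c, m_comm := ?_, f_comm := ?_ }, ?_⟩
  · funext x
    refine hj.1 ((ha _).trans ((m_comm_apply t x).trans ?_))
    exact (congrArg T.m (hc x).symm).trans (m_comm_apply j (c x)).symm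
  · funext x
    refine hj.2.1 ((hb _).trans ((f_comm_apply t x).trans ?_))
    exact (congrArg T.f (hc x).symm).trans (f_comm_apply j (c x)).symm
  · ext x
    exacts [ha x, hb x, hc x]

theorem incl_map_comp_injective
    (hj : Function.Injective j.a ∧ Function.Injective j.b ∧ Function.Injective j.c)
    {R : MonoSpan FintypeCat.Skeleton.{v}} {s t : R ⟶ S}
    (h : incl.map s ≫ j = incl.map t ≫ j) : s = t := by
  ext
  · funext x
    exact hj.1 (ConcreteCategory.congr_hom (congrArg Hom.a h) x)
  · funext x
    exact hj.2.1 (ConcreteCategory.congr_hom (congrArg Hom.b h) x)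
  · funext x
    exact hj.2.2 (ConcreteCategory.congr_hom (congrArg Hom.c h) x)

end

/-- Two finite spans over `T` factor through the finite subspan formed by the union of their images,
and parallel maps over `T` are coequalized by passing to the image of their target. It follows that
`incl` preserves finite colimits. -/
instance : RepresentablyCoflat incl.{v} where
  filtered T :=
    { cocone_objs := fun X Y => by
        obtain ⟨S, j, hj, ha, hb, hc⟩ := exists_incl_obj_hom T
          (Set.range X.hom.a ∪ Set.range Y.hom.a) (Set.range X.hom.b ∪ Set.range Y.hom.b)
          (Set.range X.hom.c ∪ Set.range Y.hom.c)
          (by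
            rintro _ (⟨x, rfl⟩ | ⟨x, rfl⟩)
            exacts [.inl ⟨_, m_comm_apply X.hom x⟩, .inr ⟨_, m_comm_apply Y.hom x⟩])
          (by
            rintro _ (⟨x, rfl⟩ | ⟨x, rfl⟩)
            exacts [.inl ⟨_, f_comm_apply X.hom x⟩, .inr ⟨_, f_comm_apply Y.hom x⟩])
        obtain ⟨s, hs⟩ := exists_incl_map_comp hj X.hom (fun x => ha _ (.inl ⟨x, rfl⟩))
          (fun x => hb _ (.inl ⟨x, rfl⟩)) (fun x => hc _ (.inl ⟨x, rfl⟩))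
        obtain ⟨t, ht⟩ := exists_incl_map_comp hj Y.hom (fun x => ha _ (.inr ⟨x, rfl⟩))
          (fun x => hb _ (.inr ⟨x, rfl⟩)) (fun x => hc _ (.inr ⟨x, rfl⟩))
        exact ⟨CostructuredArrow.mk j, CostructuredArrow.homMk s hs,
          CostructuredArrow.homMk t ht, trivial⟩
      cocone_maps := fun X Y p q => by
        obtain ⟨S, j, hj, ha, hb, hc⟩ := exists_incl_obj_hom T (Set.range Y.hom.a)
          (Set.range Y.hom.b) (Set.range Y.hom.c)
          (by
            rintro _ ⟨x, rfl⟩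
            exact ⟨_, m_comm_apply Y.hom x⟩)
          (by
            rintro _ ⟨x, rfl⟩
            exact ⟨_, f_comm_apply Y.hom x⟩)
        obtain ⟨t, ht⟩ := exists_incl_map_comp hj Y.hom (fun x => ha _ ⟨x, rfl⟩)
          (fun x => hb _ ⟨x, rfl⟩) (fun x => hc _ ⟨x, rfl⟩)
        refine ⟨CostructuredArrow.mk j, CostructuredArrow.homMk t ht, ?_⟩
        apply CostructuredArrow.hom_ext
        apply incl_map_comp_injective hj
        have hp : incl.map (p.left ≫ t) ≫ j = X.hom := by
          rw [Functor.map_comp, Category.assoc, ht, CostructuredArrow.w]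
        have hq : incl.map (q.left ≫ t) ≫ j = X.hom := by
          rw [Functor.map_comp, Category.assoc, ht, CostructuredArrow.w]
        exact hp.trans hq.symm
      nonempty := by
        obtain ⟨S, j, -⟩ := exists_incl_obj_hom T ∅ ∅ ∅ (by simp) (by simp)
        exact ⟨CostructuredArrow.mk j⟩ }

/-- The presheaf of spans of sets represented by a span. -/
def toPresheaf (T : MonoSpan C) : Cᵒᵖ ⥤ MonoSpan (Type v) where
  obj X :=
    { A := X.unop ⟶ T.A
      B := X.unop ⟶ T.B
      C := X.unop ⟶ T.C
      m := ↾fun x => x ≫ T.m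
      f := ↾fun x => x ≫ T.f
      mono := (mono_iff_injective _).2 fun _ _ e => (cancel_mono T.m).1 e }
  map r :=
    { a := ↾fun x => r.unop ≫ x
      b := ↾fun x => r.unop ≫ x
      c := ↾fun x => r.unop ≫ x
      m_comm := by ext x; exact (Category.assoc _ _ _).symm
      f_comm := by ext x; exact (Category.assoc _ _ _).symm }
  map_id X := by ext x <;> exact Category.id_comp _
  map_comp r s := by ext x <;> exact Category.assoc _ _ _

/-- The functor on the free finitely complete category on a span which classifies a given span,
valued in presheaves. -/
def classify (T : MonoSpan C) : FreeMonoSpan.{v} ⥤ Cᵒᵖ ⥤ Type v :=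
  incl.op ⋙ coyoneda ⋙ (Functor.whiskeringLeft Cᵒᵖ (MonoSpan (Type v)) (Type v)).obj T.toPresheaf

instance (T : MonoSpan C) : PreservesFiniteLimits T.classify := by
  have : PreservesFiniteColimits incl.{v} := preservesFiniteColimits_of_coflat _
  have : PreservesFiniteLimits incl.{v}.op := preservesFiniteLimits_op _
  have : PreservesFiniteLimits (coyoneda (C := MonoSpan (Type v))) := ⟨fun _ _ _ => inferInstance⟩
  have : PreservesFiniteLimits
      ((Functor.whiskeringLeft Cᵒᵖ (MonoSpan (Type v)) (Type v)).obj T.toPresheaf) :=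
    ⟨fun _ _ _ => inferInstance⟩
  have := comp_preservesFiniteLimits (coyoneda (C := MonoSpan (Type v)))
    ((Functor.whiskeringLeft Cᵒᵖ (MonoSpan (Type v)) (Type v)).obj T.toPresheaf)
  exact comp_preservesFiniteLimits _ _

variable (T : MonoSpan C)

/-- `T.classify` sends the codomain of the monic leg of the generic span to the one of `T`. -/
def classifyObjA : T.classify.obj FreeMonoSpan.A ≅ yoneda.obj T.A :=
  NatIso.ofComponents (fun X =>
    { hom := ↾fun g => Hom.a g ⟨(0 : Fin 1)⟩
      inv := ↾fun x =>
        { a := ↾fun _ => x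
          b := ↾fun z => z.down.elim0
          c := ↾fun z => z.down.elim0
          m_comm := by ext z; exact z.down.elim0
          f_comm := by ext z; exact z.down.elim0 }
      hom_inv_id := by
        refine ConcreteCategory.hom_ext _ _ fun g => Hom.ext ?_ ?_ ?_
        · ext ⟨z⟩
          obtain rfl : z = (0 : Fin 1) := Subsingleton.elim (α := Fin 1) _ _
          rfl
        · ext z; exact z.down.elim0
        · ext z; exact z.down.elim0
      inv_hom_id := rfl }) fun r => rfl

/-- `T.classify` sends the codomain of the other leg of the generic span to the one of `T`. -/
def classifyObjB : T.classify.obj FreeMonoSpan.B ≅ yoneda.obj T.B :=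
  NatIso.ofComponents (fun X =>
    { hom := ↾fun g => Hom.b g ⟨(0 : Fin 1)⟩
      inv := ↾fun x =>
        { a := ↾fun z => z.down.elim0
          b := ↾fun _ => x
          c := ↾fun z => z.down.elim0
          m_comm := by ext z; exact z.down.elim0
          f_comm := by ext z; exact z.down.elim0 }
      hom_inv_id := by
        refine ConcreteCategory.hom_ext _ _ fun g => Hom.ext ?_ ?_ ?_
        · ext z; exact z.down.elim0
        · ext ⟨z⟩
          obtain rfl : z = (0 : Fin 1) := Subsingleton.elim (α := Fin 1) _ _
          rfl
        · ext z; exact z.down.elim0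
      inv_hom_id := rfl }) fun r => rfl

/-- `T.classify` sends the apex of the generic span to the one of `T`. -/
def classifyObjC : T.classify.obj FreeMonoSpan.C ≅ yoneda.obj T.C :=
  NatIso.ofComponents (fun X =>
    { hom := ↾fun g => Hom.c g ⟨(0 : Fin 1)⟩
      inv := ↾fun x =>
        { a := ↾fun _ => x ≫ T.m
          b := ↾fun _ => x ≫ T.f
          c := ↾fun _ => x
          m_comm := rfl
          f_comm := rfl }
      hom_inv_id := by
        refine ConcreteCategory.hom_ext _ _ fun g => Hom.ext ?_ ?_ ?_
        · ext ⟨z⟩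
          obtain rfl : z = (0 : Fin 1) := Subsingleton.elim (α := Fin 1) _ _
          exact (m_comm_apply g ⟨(0 : Fin 1)⟩).symm
        · ext ⟨z⟩
          obtain rfl : z = (0 : Fin 1) := Subsingleton.elim (α := Fin 1) _ _
          exact (f_comm_apply g ⟨(0 : Fin 1)⟩).symm
        · ext ⟨z⟩
          obtain rfl : z = (0 : Fin 1) := Subsingleton.elim (α := Fin 1) _ _
          rfl
      inv_hom_id := rfl }) fun r => rfl

theorem classify_map_m : T.classify.map FreeMonoSpan.m ≫ T.classifyObjA.hom =
    T.classifyObjC.hom ≫ yoneda.map T.m := by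
  ext X g
  exact m_comm_apply g ⟨(0 : Fin 1)⟩

theorem classify_map_f : T.classify.map FreeMonoSpan.f ≫ T.classifyObjB.hom =
    T.classifyObjC.hom ≫ yoneda.map T.f := by
  ext X g
  exact f_comm_apply g ⟨(0 : Fin 1)⟩

end MonoSpan

/-! ### Presheaf pushouts of representable spans lie in the closure -/

theorem LexClosure.comp_coyoneda_obj (Φ : Set LexWeight.{v}) {P : Cᵒᵖ ⥤ Type v}
    (hP : LexClosure Φ C P) (n : ℕ) :
    LexClosure Φ C (P ⋙ coyoneda.obj (op (ULift.{v} (Fin n)))) := by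
  let c : Fan fun _ : Fin n => P := Fan.mk (P ⋙ coyoneda.obj (op (ULift.{v} (Fin n))))
    fun i => { app := fun X => ↾fun (h : ULift.{v} (Fin n) ⟶ P.obj X) => h ⟨i⟩ }
  have hc : IsLimit c := Fan.IsLimit.mk _
    (fun s => { app := fun X => ↾fun z => ↾fun i => (s.proj i.down).app X z
                naturality := fun X Y r => by
                  refine congrArg TypeCat.ofHom (funext fun z =>
                    congrArg TypeCat.ofHom (funext fun i : ULift.{v} (Fin n) => ?_))
                  exact NatTrans.naturality_apply (s.proj i.down) r z })
    (fun s i => rfl)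
    (fun s g hg => by
      ext X : 2
      refine congrArg TypeCat.ofHom (funext fun z =>
        congrArg TypeCat.ofHom (funext fun i : ULift.{v} (Fin n) => ?_))
      exact ConcreteCategory.congr_hom (congr_app (hg i.down) X) z)
  exact ObjectProperty.prop_of_isLimit _ hc fun _ => hP

namespace MonoSpan

variable (T : MonoSpan C)

/-- The values of `T.classify` are finite limits of representable presheaves. -/
theorem lexClosure_classify_obj (Φ : Set LexWeight.{v}) (S : FreeMonoSpan.{v}) :
    LexClosure Φ C (T.classify.obj S) := by
  let S' := S.unop
  have hA (n : ℕ) := LexClosure.comp_coyoneda_obj Φ (.representable T.A) n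
  have hB (n : ℕ) := LexClosure.comp_coyoneda_obj Φ (.representable T.B) n
  have hZ (n : ℕ) := LexClosure.comp_coyoneda_obj Φ (.representable T.C) n
  -- A map of spans out of a finite span is a triple of elements of finite powers subject to two
  -- equations. This exhibits the value as an iterated pullback: first over the equation for `m`,
  -- then over the one for `f`.
  let pow (X : C) (R : FintypeCat.Skeleton.{v}) : Cᵒᵖ ⥤ Type v :=
    yoneda.obj X ⋙ coyoneda.obj (op (ULift.{v} (Fin R.len)))
  let α : pow T.A S'.A ⟶ pow T.A S'.C :=
    Functor.whiskerLeft _ (coyoneda.map (Quiver.Hom.op (incl.obj S').m))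
  let β : pow T.C S'.C ⟶ pow T.A S'.C := Functor.whiskerRight (yoneda.map T.m) _
  let γ : pow T.B S'.B ⟶ pow T.B S'.C :=
    Functor.whiskerLeft _ (coyoneda.map (Quiver.Hom.op (incl.obj S').f))
  let δ : pow T.C S'.C ⟶ pow T.B S'.C := Functor.whiskerRight (yoneda.map T.f) _
  let a : T.classify.obj S ⟶ pow T.A S'.A := { app := fun X => ↾fun g => Hom.a g }
  let b : T.classify.obj S ⟶ pow T.B S'.B := { app := fun X => ↾fun g => Hom.b g }
  let c : T.classify.obj S ⟶ pow T.C S'.C := { app := fun X => ↾fun g => Hom.c g }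
  have hac : a ≫ α = c ≫ β := by
    ext X : 2
    refine ConcreteCategory.hom_ext _ _ fun g => ?_
    exact Hom.m_comm g
  have hbc : b ≫ γ = c ≫ δ := by
    ext X : 2
    refine ConcreteCategory.hom_ext _ _ fun g => ?_
    exact Hom.f_comm g
  have hU : IsPullback (pullback.fst α β) (pullback.snd α β) α β := .of_hasPullback α β
  let l := hU.lift a c hac
  have hl₁ : l ≫ pullback.fst α β = a := hU.lift_fst _ _ _
  have hl₂ : l ≫ pullback.snd α β = c := hU.lift_snd _ _ _
  have hU' : LexClosure Φ C (pullback α β) := by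
    refine ObjectProperty.prop_of_isLimit _ (c := hU.cone) hU.isLimit ?_
    rintro (_ | _ | _)
    exacts [hA _, hA _, hZ _]
  have hD : IsPullback b l γ (pullback.snd α β ≫ δ) := by
    refine IsPullback.of_forall_isPullback_app fun X => ?_
    rw [Types.isPullback_iff]
    refine ⟨?_, ?_, ?_⟩
    · rw [← NatTrans.comp_app, ← NatTrans.comp_app, hbc, reassoc_of% hl₂]
    · rintro g h ⟨e₁, e₂⟩
      refine Hom.ext ?_ e₁ ?_
      · change a.app X g = a.app X h
        rw [← hl₁]
        exact congrArg ((pullback.fst α β).app X) e₂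
      · change c.app X g = c.app X h
        rw [← hl₂]
        exact congrArg ((pullback.snd α β).app X) e₂
    · intro y z e
      have e' := ConcreteCategory.congr_hom (congr_app hU.w X) z
      refine ⟨{ a := (pullback.fst α β).app X z, b := y, c := (pullback.snd α β).app X z
                m_comm := e'
                f_comm := e }, rfl, ?_⟩
      refine Types.ext_of_isPullback (hU.app X) ?_ ?_
      · exact ConcreteCategory.congr_hom (congr_app hl₁ X) _
      · exact ConcreteCategory.congr_hom (congr_app hl₂ X) _
  refine ObjectProperty.prop_of_isLimit _ hD.isLimit ?_
  rintro (_ | _ | _)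
  exacts [hB _, hB _, hU']

theorem lexClosure_of_isPushout {P : Cᵒᵖ ⥤ Type v} {i : yoneda.obj T.A ⟶ P}
    {j : yoneda.obj T.B ⟶ P} (h : IsPushout (yoneda.map T.m) (yoneda.map T.f) i j) :
    LexClosure PhiAdh.{v} C P := by
  let c : WeightedCocone adhWeight.{v}.φ T.classify := colimit.cocone _
  have hc : IsColimit c := colimit.isColimit _
  obtain ⟨i', j', h'⟩ := isPushout_of_isColimit_adhWeight T.classify hc
  have h'' := h'.of_iso T.classifyObjC T.classifyObjA T.classifyObjB (Iso.refl _)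
    T.classify_map_m T.classify_map_f (inl' := T.classifyObjA.inv ≫ i')
    (inr' := T.classifyObjB.inv ≫ j') (by simp) (by simp)
  let e := h''.isoIsPushout _ _ h
  exact .lex_colimit adhWeight (show adhWeight ∈ PhiAdh from rfl) T.classify
    (inferInstanceAs (PreservesFiniteLimits (C := FreeMonoSpan) T.classify)) (T.lexClosure_classify_obj _)
    (c.extend e.hom) (hc.extendIso e.hom)

end MonoSpan

/-! ### Lex-reflections of presheaves -/

instance (Φ : Set LexWeight.{v}) : (lexYoneda Φ C).Full :=
  inferInstanceAs ((LexClosure Φ C).lift yoneda LexClosure.representable).Full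

instance (Φ : Set LexWeight.{v}) : (lexYoneda Φ C).Faithful :=
  inferInstanceAs ((LexClosure Φ C).lift yoneda LexClosure.representable).Faithful

namespace LexCompletion

variable {Φ : Set LexWeight.{v}} {L : LexCompletion Φ C ⥤ C} (adj : L ⊣ lexYoneda Φ C)

/-- The transpose of a map from a presheaf to a representable presheaf. -/
def transpose {P : Cᵒᵖ ⥤ Type v} (hP : LexClosure Φ C P) {D : C} (κ : P ⟶ yoneda.obj D) :
    L.obj ⟨P, hP⟩ ⟶ D :=
  L.map (ObjectProperty.homMk κ : (⟨P, hP⟩ : LexCompletion Φ C) ⟶ (lexYoneda Φ C).obj D) ≫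
    adj.counit.app D

/-- The reflection of a map from a representable presheaf. -/
def reflect {P : Cᵒᵖ ⥤ Type v} (hP : LexClosure Φ C P) {A : C} (i : yoneda.obj A ⟶ P) :
    A ⟶ L.obj ⟨P, hP⟩ :=
  inv (adj.counit.app A) ≫
    L.map (ObjectProperty.homMk i : (lexYoneda Φ C).obj A ⟶ (⟨P, hP⟩ : LexCompletion Φ C))

theorem map_homMk_comp_transpose {P P' : Cᵒᵖ ⥤ Type v} (hP : LexClosure Φ C P)
    (hP' : LexClosure Φ C P') {D D' : C} {π : P' ⟶ P} {κ : P ⟶ yoneda.obj D}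
    {κ' : P' ⟶ yoneda.obj D'} {d : D' ⟶ D} (h : π ≫ κ = κ' ≫ yoneda.map d) :
    L.map (ObjectProperty.homMk π : (⟨P', hP'⟩ : LexCompletion Φ C) ⟶ ⟨P, hP⟩) ≫
      transpose adj hP κ = transpose adj hP' κ' ≫ d := by
  have e : (ObjectProperty.homMk π : (⟨P', hP'⟩ : LexCompletion Φ C) ⟶ ⟨P, hP⟩) ≫
      (ObjectProperty.homMk κ : (⟨P, hP⟩ : LexCompletion Φ C) ⟶ (lexYoneda Φ C).obj D) =
      (ObjectProperty.homMk κ' : (⟨P', hP'⟩ : LexCompletion Φ C) ⟶ (lexYoneda Φ C).obj D') ≫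
        (lexYoneda Φ C).map d := ObjectProperty.hom_ext _ h
  rw [transpose, transpose, ← Functor.map_comp_assoc, e, Functor.map_comp_assoc, Category.assoc]
  exact congrArg _ (adj.counit.naturality d)

theorem transpose_id (D : C) :
    transpose adj (.representable D) (𝟙 (yoneda.obj D)) = adj.counit.app D := by
  have e : L.map (ObjectProperty.homMk (𝟙 (yoneda.obj D)) :
      (lexYoneda Φ C).obj D ⟶ (lexYoneda Φ C).obj D) = 𝟙 _ := L.map_id _
  exact (e =≫ _).trans (Category.id_comp _)

theorem map_homMk_comp_transpose_of_representable {P : Cᵒᵖ ⥤ Type v} (hP : LexClosure Φ C P)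
    {A D : C} {i : yoneda.obj A ⟶ P} {κ : P ⟶ yoneda.obj D} {g : A ⟶ D}
    (h : i ≫ κ = yoneda.map g) :
    L.map (ObjectProperty.homMk i : (lexYoneda Φ C).obj A ⟶ (⟨P, hP⟩ : LexCompletion Φ C)) ≫
      transpose adj hP κ = adj.counit.app A ≫ g := by
  rw [← transpose_id]
  exact map_homMk_comp_transpose adj hP (.representable A) (h.trans (Category.id_comp _).symm)

theorem reflect_transpose {P : Cᵒᵖ ⥤ Type v} (hP : LexClosure Φ C P) {A D : C}
    (i : yoneda.obj A ⟶ P) (κ : P ⟶ yoneda.obj D) {g : A ⟶ D} (h : i ≫ κ = yoneda.map g) :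
    reflect adj hP i ≫ transpose adj hP κ = g := by
  rw [reflect, Category.assoc, IsIso.inv_comp_eq]
  exact map_homMk_comp_transpose_of_representable adj hP h

section

variable {A B Z : C} {m : Z ⟶ A} {f : Z ⟶ B} {P : Cᵒᵖ ⥤ Type v} {i : yoneda.obj A ⟶ P}
  {j : yoneda.obj B ⟶ P}

theorem isPushout_reflect (hP : LexClosure Φ C P)
    (h : IsPushout (yoneda.map m) (yoneda.map f) i j) :
    IsPushout m f (reflect adj hP i) (reflect adj hP j) := by
  have h₁ : IsPushout ((lexYoneda Φ C).map m) ((lexYoneda Φ C).map f)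
      (ObjectProperty.homMk i : (lexYoneda Φ C).obj A ⟶ (⟨P, hP⟩ : LexCompletion Φ C))
      (ObjectProperty.homMk j : (lexYoneda Φ C).obj B ⟶ (⟨P, hP⟩ : LexCompletion Φ C)) :=
    IsPushout.of_map (LexClosure Φ C).ι (ObjectProperty.hom_ext _ h.w) h
  have := adj.leftAdjoint_preservesColimits
  refine (h₁.map L).of_iso (asIso (adj.counit.app Z)) (asIso (adj.counit.app A))
    (asIso (adj.counit.app B)) (Iso.refl _) (adj.counit.naturality m) (adj.counit.naturality f)
    ?_ ?_ <;> simp [reflect]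

/-- `L` sends `P` to a pushout of `m` and `f`, and the transpose of `κ` is the comparison map from
it to `D`. -/
theorem isPushout_iff_isIso_transpose (hP : LexClosure Φ C P)
    (h : IsPushout (yoneda.map m) (yoneda.map f) i j) {D : C} {g : A ⟶ D} {n : B ⟶ D}
    {κ : P ⟶ yoneda.obj D} (hi : i ≫ κ = yoneda.map g) (hj : j ≫ κ = yoneda.map n) :
    IsPushout m f g n ↔ IsIso (transpose adj hP κ) := by
  have h₁ := isPushout_reflect adj hP h
  have hg := reflect_transpose adj hP i κ hi
  have hn := reflect_transpose adj hP j κ hj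
  constructor
  · intro h₂
    have e : transpose adj hP κ = (h₁.isoIsPushout _ _ h₂).hom :=
      h₁.hom_ext (by simp [hg]) (by simp [hn])
    rw [e]
    infer_instance
  · intro h₂
    exact h₁.of_iso (Iso.refl _) (Iso.refl _) (Iso.refl _) (asIso (transpose adj hP κ))
      (by simp) (by simp) (by simp [hg]) (by simp [hn])

end

end LexCompletion

/-! ### From exactness to adhesiveness -/

open LexCompletion

theorem IsPhiExact.adhesive [HasFiniteLimits C] (h : IsPhiExact PhiAdh.{v} C) : Adhesive C := by
  obtain ⟨L, ⟨adj⟩, hL⟩ := h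
  have hP {A B Z : C} (m : Z ⟶ A) (f : Z ⟶ B) [Mono m] {P : Cᵒᵖ ⥤ Type v}
      {i : yoneda.obj A ⟶ P} {j : yoneda.obj B ⟶ P}
      (h : IsPushout (yoneda.map m) (yoneda.map f) i j) : LexClosure PhiAdh.{v} C P :=
    MonoSpan.lexClosure_of_isPushout { A := A, B := B, C := Z, m := m, f := f } h
  have hpush {A B Z : C} (m : Z ⟶ A) (f : Z ⟶ B) [Mono m] : HasPushout m f :=
    (isPushout_reflect adj (hP m f (.of_hasPushout _ _)) (.of_hasPushout _ _)).hasPushout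
  refine { hasPushout_of_mono_left := fun m f _ => hpush m f, van_kampen := ?_ }
  intro W X Y Z f g h i hf H W' X' Y' Z' f' g' h' i' αW αX αY αZ hbf hbg hh hi hw
  have hf' : Mono f' := ⟨fun a b e => hbf.hom_ext e (by
    rw [← cancel_mono f, Category.assoc, Category.assoc, ← hbf.w, reassoc_of% e])⟩
  obtain ⟨P, p, q, h₁⟩ : ∃ (P : Cᵒᵖ ⥤ Type v) (p : yoneda.obj X ⟶ P) (q : yoneda.obj Y ⟶ P),
    IsPushout (yoneda.map f) (yoneda.map g) p q := ⟨_, _, _, .of_hasPushout _ _⟩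
  -- Presheaf categories are adhesive, so the pushout `P` is van Kampen.
  have vk := Adhesive.van_kampen h₁
  let κ := h₁.desc (yoneda.map h) (yoneda.map i)
    (by rw [← Functor.map_comp, H.w, Functor.map_comp])
  have hp : p ≫ κ = yoneda.map h := h₁.inl_desc _ _ _
  have hq : q ≫ κ = yoneda.map i := h₁.inr_desc _ _ _
  have hPc := hP f g h₁
  have hκ : IsIso (transpose adj hPc κ) := (isPushout_iff_isIso_transpose adj hPc h₁ hp hq).1 H
  constructor
  · intro H'
    obtain ⟨P', p', q', h₂⟩ : ∃ (P : Cᵒᵖ ⥤ Type v) (p : yoneda.obj X' ⟶ P)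
      (q : yoneda.obj Y' ⟶ P), IsPushout (yoneda.map f') (yoneda.map g') p q :=
      ⟨_, _, _, .of_hasPushout _ _⟩
    let κ' := h₂.desc (yoneda.map h') (yoneda.map i')
      (by rw [← Functor.map_comp, H'.w, Functor.map_comp])
    have hp' : p' ≫ κ' = yoneda.map h' := h₂.inl_desc _ _ _
    have hq' : q' ≫ κ' = yoneda.map i' := h₂.inr_desc _ _ _
    have hPc' := hP f' g' h₂
    have hκ' : IsIso (transpose adj hPc' κ') :=
      (isPushout_iff_isIso_transpose adj hPc' h₂ hp' hq').1 H'
    let π : P' ⟶ P := h₂.desc (yoneda.map αX ≫ p) (yoneda.map αY ≫ q) (by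
      rw [← Functor.map_comp_assoc, ← Functor.map_comp_assoc, hbf.w, hbg.w, Functor.map_comp,
        Functor.map_comp, Category.assoc, Category.assoc, h₁.w])
    have hπp : p' ≫ π = yoneda.map αX ≫ p := h₂.inl_desc _ _ _
    have hπq : q' ≫ π = yoneda.map αY ≫ q := h₂.inr_desc _ _ _
    have hπκ : π ≫ κ = κ' ≫ yoneda.map αZ := h₂.hom_ext
      (by rw [reassoc_of% hπp, hp, reassoc_of% hp', ← Functor.map_comp, ← Functor.map_comp, hh.w])
      (by rw [reassoc_of% hπq, hq, reassoc_of% hq', ← Functor.map_comp, ← Functor.map_comp, hi.w])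
    obtain ⟨hX, hY⟩ := (vk _ _ _ _ _ _ _ π (hbf.map yoneda) (hbg.map yoneda) ⟨hπp⟩ ⟨hπq⟩ h₂.1).1 h₂
    -- `L` preserves the front pullbacks over `P`. The counit and the two invertible transposes
    -- identify the result with the front faces in `C`.
    have key {V V' : C} {k : V ⟶ Z} {k' : V' ⟶ Z'} {α : V' ⟶ V} {r : yoneda.obj V ⟶ P}
        {r' : yoneda.obj V' ⟶ P'} (hr : r ≫ κ = yoneda.map k) (hr' : r' ≫ κ' = yoneda.map k')
        (hV : IsPullback r' (yoneda.map α) π r) : IsPullback k' α αZ k := by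
      have hV' : IsPullback
          (ObjectProperty.homMk r' : (lexYoneda PhiAdh C).obj V' ⟶
            (⟨P', hPc'⟩ : LexCompletion PhiAdh C))
          ((lexYoneda PhiAdh C).map α)
          (ObjectProperty.homMk π : (⟨P', hPc'⟩ : LexCompletion PhiAdh C) ⟶ ⟨P, hPc⟩)
          (ObjectProperty.homMk r : (lexYoneda PhiAdh C).obj V ⟶
            (⟨P, hPc⟩ : LexCompletion PhiAdh C)) :=
        IsPullback.of_map (LexClosure PhiAdh C).ι (ObjectProperty.hom_ext _ hV.w) hV
      exact (hV'.map L).of_iso (asIso (adj.counit.app V')) (asIso (transpose adj hPc' κ'))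
        (asIso (adj.counit.app V)) (asIso (transpose adj hPc κ))
        (map_homMk_comp_transpose_of_representable adj hPc' hr') (adj.counit.naturality α)
        (map_homMk_comp_transpose adj hPc hPc' hπκ)
        (map_homMk_comp_transpose_of_representable adj hPc hr)
    exact ⟨key hp hp' hX, key hq hq' hY⟩
  · rintro ⟨hX, hY⟩
    -- Pulling `P` back along `αZ` gives a presheaf cube whose front faces are pullbacks, so `Q` is
    -- the pushout of the top span. As `L` inverts `κ` and preserves pullbacks, it inverts `κ'` too.
    obtain ⟨Q, π, κ', hQ⟩ : ∃ (Q : Cᵒᵖ ⥤ Type v) (π : Q ⟶ P) (κ' : Q ⟶ yoneda.obj Z'),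
      IsPullback κ' π (yoneda.map αZ) κ := ⟨_, _, _, .of_hasPullback _ _⟩
    have key {V V' : C} {k : V ⟶ Z} {k' : V' ⟶ Z'} {α : V' ⟶ V} {r : yoneda.obj V ⟶ P}
        (hr : r ≫ κ = yoneda.map k) (hV : IsPullback k' α αZ k) :
        ∃ r' : yoneda.obj V' ⟶ Q, r' ≫ κ' = yoneda.map k' ∧ IsPullback r' (yoneda.map α) π r := by
      have hl : yoneda.map k' ≫ yoneda.map αZ = (yoneda.map α ≫ r) ≫ κ := by
        rw [Category.assoc, hr, ← Functor.map_comp, hV.w, Functor.map_comp]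
      refine ⟨hQ.lift _ _ hl, hQ.lift_fst _ _ hl, ?_⟩
      refine IsPullback.of_right ?_ (hQ.lift_snd _ _ hl) hQ
      rw [hQ.lift_fst, hr]
      exact hV.map yoneda
    obtain ⟨p', hp', hX'⟩ := key hp hX
    obtain ⟨q', hq', hY'⟩ := key hq hY
    have hw' : yoneda.map f' ≫ p' = yoneda.map g' ≫ q' := hQ.hom_ext
      (by rw [Category.assoc, Category.assoc, hp', hq', ← Functor.map_comp, hw.w,
        Functor.map_comp])
      (by rw [Category.assoc, Category.assoc, hX'.w, hY'.w, ← Functor.map_comp_assoc,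
        ← Functor.map_comp_assoc, hbf.w, hbg.w, Functor.map_comp, Functor.map_comp,
        Category.assoc, Category.assoc, h₁.w])
    have h₂ := (vk _ _ _ _ _ _ _ π (hbf.map yoneda) (hbg.map yoneda) ⟨hX'.w⟩ ⟨hY'.w⟩ ⟨hw'⟩).2
      ⟨hX', hY'⟩
    have hQc := hP f' g' h₂
    refine (isPushout_iff_isIso_transpose adj hQc h₂ hp' hq').2 ?_
    have hQ' : IsPullback
        (ObjectProperty.homMk κ' : (⟨Q, hQc⟩ : LexCompletion PhiAdh C) ⟶
          (lexYoneda PhiAdh C).obj Z')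
        (ObjectProperty.homMk π : (⟨Q, hQc⟩ : LexCompletion PhiAdh C) ⟶ ⟨P, hPc⟩)
        ((lexYoneda PhiAdh C).map αZ)
        (ObjectProperty.homMk κ : (⟨P, hPc⟩ : LexCompletion PhiAdh C) ⟶
          (lexYoneda PhiAdh C).obj Z) :=
      IsPullback.of_map (LexClosure PhiAdh C).ι (ObjectProperty.hom_ext _ hQ.w) hQ
    have : IsIso (L.map (ObjectProperty.homMk κ : (⟨P, hPc⟩ : LexCompletion PhiAdh C) ⟶
        (lexYoneda PhiAdh C).obj Z)) := by
      rw [transpose] at hκ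
      exact IsIso.of_isIso_comp_right _ (adj.counit.app Z)
    have := (hQ'.map L).isIso_fst_of_isIso
    rw [transpose]
    infer_instance

/-- Base change along a map into `D` produces a cube whose rear and front faces are pullbacks, so
the van Kampen condition makes its top face a pushout. -/
theorem Adhesive.hasStableMonoPushouts [Adhesive C] [HasPullbacks C] :
    HasStableMonoPushouts C where
  hasPushout _ _ _ _ _ _ := inferInstance
  isStable _ _ _ _ _ _ _ _ _ h _ _ _ _ _ _ _ _ _ _ _ _ hg hn hm hf hw :=
    (Adhesive.van_kampen h _ _ _ _ _ _ _ _ hm hf ⟨hg.w⟩ ⟨hn.w⟩ hw).2 ⟨hg, hn⟩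
  isPullback _ _ _ _ _ _ _ _ _ h := Adhesive.isPullback_of_isPushout_of_mono_left h

end

theorem mainTheorem9 {C : Type u} [Category.{v} C] [HasFiniteLimits C] :
    List.TFAE
      [IsPhiExact PhiAdh.{v} C,
       Adhesive C,
       (∀ ⦃X Y Z : C⦄ (m : Z ⟶ X) (f : Z ⟶ Y), Mono m → HasPushout m f) ∧
       (∀ ⦃X Y Z D : C⦄ (m : Z ⟶ X) (f : Z ⟶ Y) (g : X ⟶ D) (n : Y ⟶ D),
          Mono m → IsPushout m f g n → IsStablePushout m f g n) ∧
       (∀ ⦃X Y Z D : C⦄ (m : Z ⟶ X) (f : Z ⟶ Y) (g : X ⟶ D) (n : Y ⟶ D),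
          Mono m → IsPushout m f g n → IsPullback m f g n)] := by
  tfae_have 1 → 2 := IsPhiExact.adhesive
  tfae_have 2 → 3 := fun _ =>
    let h := Adhesive.hasStableMonoPushouts (C := C)
    ⟨h.hasPushout, h.isStable, h.isPullback⟩
  tfae_have 3 → 1 := fun h => HasStableMonoPushouts.isPhiExact ⟨h.1, h.2.1, h.2.2⟩
  tfae_finish
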